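/- Let $(X_n,\|\cdot\|_n)_{n\ge 1}$ be any sequence of finite-dimensional complex Banach spaces, and let $$X=\Big\{x=(x_n)_{n\ge1} : x_n\in X_n,\ \|x\|=\sum_{n\ge 1}\|x_n\|_n<\infty\Big\}$$ be their $\ell_1$-sum. For $0<\rho\le\infty$ let $B_X(\rho)=\{x\in X:\|x\|<\rho\}$. Then for all $0<r<R\le\infty$, every $\varepsilon>0$, and every holomorphic (that is, complex Fréchet differentiable) function $f:B_X(R)\to\mathbb{C}$ there exists an entire function $g:X\to\mathbb{C}$ (holomorphic on all of $X$) such that $|f(x)-g(x)|<\varepsilon$ for all $x\in B_X(r)$. -/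

import Mathlib

open scoped ENNReal

/-!
The function `f` is expanded into its multihomogeneous components. For a multi-index `k` with finite
support, the component `f_k` is the Fourier coefficient of index `k` of `ω ↦ f (ω • x)`, where `ω`
runs through the infinite torus, which rotates each variable separately
(`torusCoeff`, `component`); each `f_k` extends to an entire function. The function `g` is the sum
of those `f_k` that are large in the sense of `largeIndices`, i.e. that violate
`‖f_k x‖ ≤ ε' * m_k * ∏ n, (‖x n‖ / r₁) ^ k n` for some `x`. Here `m_k` is the multinomial coefficient
and `r < r₁ < R`. By the multinomial theorem the discarded components sum to at most
`ε' / (1 - r / r₁)` on the ball of radius `r`.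

That `g` is entire rests on Cauchy estimates with variable weights
(`exists_norm_component_le`). If `σ n → 0` and `σ n ≤ ρ < R`, then `∑ ‖y n‖ / σ n ≤ 1` defines a
compact set, because each `X n` is finite-dimensional, so `f` is bounded on a uniform
neighbourhood of it. This gives `‖f_k x‖ ≤ C * m_k * ∏ n, (‖x n‖ / τ n) ^ k n` with weights `τ` that
are at least `κ * σ` and bounded below, for any `κ < 1`. For large `k` the two bounds together say
`1 ≤ (C / ε') * ∏ n, (r₁ / τ n) ^ k n`, and multiplying the Cauchy estimate by powers of this
inequality replaces `τ` by `τ n ^ (j + 1) / r₁ ^ j` for any `j`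
(`norm_component_le_of_mem_largeIndices`). Given `x₀`, fix `ρ` and `κ` with `r₁ < κ * ρ` and then
`j` with `‖x₀‖ / r₁ < (κ * ρ / r₁) ^ (j + 1)`. If `σ` tends to `0` slowly enough, the new weights
satisfy `∑ ‖x₀ n‖ * r₁ ^ j / τ n ^ (j + 1) < 1`, so the multinomial theorem bounds the partial sums
of `∑ ‖f_k x‖` over large `k` uniformly near `x₀`. A pointwise limit of uniformly bounded holomorphic
functions is holomorphic (`differentiableAt_of_tendsto_of_norm_le`).
-/

open MeasureTheory Filter Topology

/-! ### Integrals and limits of holomorphic functions -/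

lemma norm_sub_le_of_norm_le_ball {E : Type*} [NormedAddCommGroup E] [NormedSpace ℂ E]
    {F : E → ℂ} {x₀ : E} {δ M : ℝ} (hF : DifferentiableOn ℂ F (Metric.ball x₀ δ))
    (hM : ∀ x ∈ Metric.ball x₀ δ, ‖F x‖ ≤ M) {x : E} (hx : x ∈ Metric.ball x₀ δ) :
    ‖F x - F x₀‖ ≤ 2 * M / δ * ‖x - x₀‖ := by
  have hδ : 0 < δ := Metric.pos_of_mem_ball hx
  rw [← dist_eq_norm, ← dist_eq_norm]
  refine Complex.dist_le_div_mul_dist_of_mapsTo_ball hF (fun y hy => ?_) hx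
  rw [Metric.mem_closedBall, dist_eq_norm]
  linarith [norm_sub_le (F y) (F x₀), hM y hy, hM x₀ (Metric.mem_ball_self hδ)]

lemma norm_fderiv_le_of_norm_le_ball {E : Type*} [NormedAddCommGroup E] [NormedSpace ℂ E]
    {F : E → ℂ} {x₀ : E} {δ M : ℝ} (hδ : 0 < δ) (hF : DifferentiableOn ℂ F (Metric.ball x₀ δ))
    (hM : ∀ x ∈ Metric.ball x₀ δ, ‖F x‖ ≤ M) : ‖fderiv ℂ F x₀‖ ≤ 2 * M / δ := by
  refine Complex.norm_fderiv_le_div_of_mapsTo_ball hF (fun y hy => ?_) hδ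
  rw [Metric.mem_closedBall, dist_eq_norm]
  linarith [norm_sub_le (F y) (F x₀), hM y hy, hM x₀ (Metric.mem_ball_self hδ)]

/-- A bounded parameter integral of holomorphic functions on a ball of a complex normed space is
holomorphic. The derivative is assembled from the scalar integrals of `fderiv ℂ (F ω) x₀ h`, so no
measurability of the operator-valued map `ω ↦ fderiv ℂ (F ω) x₀` is needed. -/
lemma differentiableAt_integral_of_norm_le {E : Type*} [NormedAddCommGroup E] [NormedSpace ℂ E]
    {Ω : Type*} [MeasurableSpace Ω] {μ : Measure Ω} [IsFiniteMeasure μ] {F : Ω → E → ℂ} {x₀ : E}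
    {δ M : ℝ} (hδ : 0 < δ) (hF : ∀ ω, DifferentiableOn ℂ (F ω) (Metric.ball x₀ δ))
    (hM : ∀ ω, ∀ x ∈ Metric.ball x₀ δ, ‖F ω x‖ ≤ M)
    (hmeas : ∀ x ∈ Metric.ball x₀ δ, AEStronglyMeasurable (fun ω => F ω x) μ) :
    DifferentiableAt ℂ (fun x => ∫ ω, F ω x ∂μ) x₀ := by
  have hx₀ : x₀ ∈ Metric.ball x₀ δ := Metric.mem_ball_self hδ
  have hd (ω : Ω) : HasFDerivAt (F ω) (fderiv ℂ (F ω) x₀) x₀ :=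
    ((hF ω).differentiableAt (Metric.ball_mem_nhds x₀ hδ)).hasFDerivAt
  have hfd (ω : Ω) : ‖fderiv ℂ (F ω) x₀‖ ≤ 2 * M / δ :=
    norm_fderiv_le_of_norm_le_ball hδ (hF ω) (hM ω)
  have hint (x : E) (hx : x ∈ Metric.ball x₀ δ) : Integrable (fun ω => F ω x) μ :=
    Integrable.of_bound (hmeas x hx) M (Eventually.of_forall fun ω => hM ω x hx)
  -- `fderiv ℂ (F ω) x₀ h` is a pointwise limit of difference quotients along `h / (n + 1)`
  have hLmeas (h : E) : AEStronglyMeasurable (fun ω => fderiv ℂ (F ω) x₀ h) μ := by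
    have hsm : Tendsto (fun n : ℕ => (((n : ℂ) + 1)⁻¹)) atTop (𝓝 0) := by
      have := tendsto_one_div_add_atTop_nhds_zero_nat (𝕜 := ℂ)
      simpa using this
    have hpt : Tendsto (fun n : ℕ => x₀ + ((n : ℂ) + 1)⁻¹ • h) atTop (𝓝 x₀) := by
      simpa using tendsto_const_nhds.add (hsm.smul_const h)
    have hev : ∀ᶠ n : ℕ in atTop, x₀ + ((n : ℂ) + 1)⁻¹ • h ∈ Metric.ball x₀ δ :=
      hpt.eventually (Metric.ball_mem_nhds x₀ hδ)
    obtain ⟨n₀, hn₀⟩ := eventually_atTop.1 hev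
    refine aestronglyMeasurable_of_tendsto_ae (u := atTop)
      (f := fun (n : ℕ) ω => (((n + n₀ : ℕ) : ℂ) + 1) *
        (F ω (x₀ + (((n + n₀ : ℕ) : ℂ) + 1)⁻¹ • h) - F ω x₀)) (fun n => ?_)
      (Eventually.of_forall fun ω => ?_)
    · exact ((hmeas _ (hn₀ (n + n₀) (Nat.le_add_left _ _))).sub (hmeas _ hx₀)).const_mul _
    · have hl : Tendsto (fun n : ℕ => ((n : ℂ) + 1)⁻¹) atTop (𝓝[≠] 0) := by
        refine tendsto_nhdsWithin_iff.2 ⟨hsm, Eventually.of_forall fun n => ?_⟩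
        exact inv_ne_zero (by exact_mod_cast n.succ_ne_zero)
      have h1 := ((hd ω).hasLineDerivAt h).tendsto_slope_zero
      have h2 := (h1.comp hl).comp (tendsto_add_atTop_nat n₀)
      simpa [Function.comp_def] using h2
  have hLint (h : E) : Integrable (fun ω => fderiv ℂ (F ω) x₀ h) μ :=
    Integrable.of_bound (hLmeas h) (2 * M / δ * ‖h‖) (Eventually.of_forall fun ω =>
      (ContinuousLinearMap.le_opNorm _ _).trans (by gcongr; exact hfd ω))
  let L : E →ₗ[ℂ] ℂ :=
    { toFun := fun h => ∫ ω, fderiv ℂ (F ω) x₀ h ∂μ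
      map_add' := fun a b => by
        simp only [map_add]; exact integral_add (hLint a) (hLint b)
      map_smul' := fun c a => by
        simp only [map_smul, RingHom.id_apply]; exact integral_smul c _ }
  let L' : E →L[ℂ] ℂ := L.mkContinuous (2 * M / δ * μ.real Set.univ) fun h => by
    have := norm_integral_le_of_norm_le_const (μ := μ)
      (f := fun ω => fderiv ℂ (F ω) x₀ h) (C := 2 * M / δ * ‖h‖) (Eventually.of_forall fun ω =>
        (ContinuousLinearMap.le_opNorm _ _).trans (by gcongr; exact hfd ω))
    calc ‖L h‖ ≤ 2 * M / δ * ‖h‖ * μ.real Set.univ := this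
      _ = _ := by ring
  refine HasFDerivAt.differentiableAt (f' := L') ?_
  rw [hasFDerivAt_iff_tendsto]
  have hkey : Tendsto (fun x => ∫ ω, ‖x - x₀‖⁻¹ * ‖F ω x - F ω x₀ - fderiv ℂ (F ω) x₀ (x - x₀)‖ ∂μ)
      (𝓝 x₀) (𝓝 (∫ _, (0 : ℝ) ∂μ)) := by
    refine tendsto_integral_filter_of_dominated_convergence (fun _ => 2 * M / δ + 2 * M / δ) ?_ ?_
      (integrable_const _) (Eventually.of_forall fun ω => hasFDerivAt_iff_tendsto.1 (hd ω))
    · filter_upwards [Metric.ball_mem_nhds x₀ hδ] with x hx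
      exact ((((hmeas x hx).sub (hmeas x₀ hx₀)).sub (hLmeas _)).norm).const_mul _
    · filter_upwards [Metric.ball_mem_nhds x₀ hδ] with x hx
      refine Eventually.of_forall fun ω => ?_
      have h1 := norm_sub_le_of_norm_le_ball (hF ω) (hM ω) hx
      have h2 : ‖fderiv ℂ (F ω) x₀ (x - x₀)‖ ≤ 2 * M / δ * ‖x - x₀‖ :=
        (ContinuousLinearMap.le_opNorm _ _).trans (by gcongr; exact hfd ω)
      have h3 := (norm_sub_le (F ω x - F ω x₀) (fderiv ℂ (F ω) x₀ (x - x₀))).trans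
        (add_le_add h1 h2)
      have hMδ : 0 ≤ 2 * M / δ := (norm_nonneg _).trans (hfd ω)
      rw [Real.norm_of_nonneg (by positivity)]
      rcases eq_or_ne (‖x - x₀‖) 0 with h0 | h0
      · rw [h0]; simp; linarith
      · rw [inv_mul_le_iff₀ (by positivity)]
        linarith
  rw [integral_zero] at hkey
  refine squeeze_zero' (Eventually.of_forall fun x => by positivity) ?_ hkey
  filter_upwards [Metric.ball_mem_nhds x₀ hδ] with x hx
  rw [integral_const_mul]
  gcongr
  have : (∫ ω, F ω x ∂μ) - (∫ ω, F ω x₀ ∂μ) - L' (x - x₀)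
      = ∫ ω, (F ω x - F ω x₀ - fderiv ℂ (F ω) x₀ (x - x₀)) ∂μ := by
    have e := integral_sub (f := fun ω => F ω x - F ω x₀)
      ((hint x hx).sub (hint x₀ hx₀)) (hLint (x - x₀))
    rw [e, integral_sub (hint x hx) (hint x₀ hx₀)]
    rfl
  rw [this]
  exact norm_integral_le_integral_norm _

/-- A pointwise limit of a uniformly bounded family of holomorphic functions on a ball is
holomorphic. The derivatives at the centre are bounded, so they have a pointwise cluster point
`L`; by the Schwarz lemma the first-order Taylor remainders are `O(‖x - x₀‖ ^ 2)` uniformly in the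
family, and this bound passes to the limit. -/
lemma differentiableAt_of_tendsto_of_norm_le {E : Type*} [NormedAddCommGroup E] [NormedSpace ℂ E]
    {α : Type*} {l : Filter α} [NeBot l] {F : α → E → ℂ} {G : E → ℂ} {x₀ : E} {δ M : ℝ}
    (hδ : 0 < δ) (hF : ∀ a, DifferentiableOn ℂ (F a) (Metric.ball x₀ δ))
    (hM : ∀ a, ∀ x ∈ Metric.ball x₀ δ, ‖F a x‖ ≤ M)
    (hlim : ∀ x ∈ Metric.ball x₀ δ, Tendsto (fun a => F a x) l (𝓝 (G x))) :
    DifferentiableAt ℂ G x₀ := by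
  have hx₀ : x₀ ∈ Metric.ball x₀ δ := Metric.mem_ball_self hδ
  have hd (a : α) : HasFDerivAt (F a) (fderiv ℂ (F a) x₀) x₀ :=
    ((hF a).differentiableAt (Metric.ball_mem_nhds x₀ hδ)).hasFDerivAt
  have hfd (a : α) : ‖fderiv ℂ (F a) x₀‖ ≤ 2 * M / δ :=
    norm_fderiv_le_of_norm_le_ball hδ (hF a) (hM a)
  have hfdx (a : α) (h : E) : ‖fderiv ℂ (F a) x₀ h‖ ≤ 2 * M / δ * ‖h‖ :=
    (ContinuousLinearMap.le_opNorm _ _).trans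
      (mul_le_mul_of_nonneg_right (hfd a) (norm_nonneg h))
  obtain ⟨a₀⟩ := l.nonempty_of_neBot
  have hM0 : 0 ≤ M := (norm_nonneg _).trans (hM a₀ x₀ hx₀)
  let u : Ultrafilter α := Ultrafilter.of l
  have hul : (u : Filter α) ≤ l := Ultrafilter.of_le l
  have hex (h : E) : ∃ y, ‖y‖ ≤ 2 * M / δ * ‖h‖ ∧
      Tendsto (fun a => fderiv ℂ (F a) x₀ h) u (𝓝 y) := by
    obtain ⟨y, hy, hyl⟩ := (isCompact_closedBall (0 : ℂ) (2 * M / δ * ‖h‖)).ultrafilter_le_nhds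
      (u.map fun a => fderiv ℂ (F a) x₀ h)
      (le_principal_iff.2 (mem_map.2 (Eventually.of_forall fun a => by simpa using hfdx a h)))
    exact ⟨y, by simpa using hy, hyl⟩
  choose L hLnorm hL using hex
  let L' : E →L[ℂ] ℂ := LinearMap.mkContinuous
    { toFun := L
      map_add' := fun a b => tendsto_nhds_unique (hL (a + b)) (by
        simpa only [map_add] using (hL a).add (hL b))
      map_smul' := fun c a => tendsto_nhds_unique (hL (c • a)) (by
        simpa only [map_smul, RingHom.id_apply] using (hL a).const_smul c) } (2 * M / δ) hLnorm
  have hquad (a : α) {x : E} (hx : x ∈ Metric.ball x₀ δ) :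
      ‖F a x - F a x₀ - fderiv ℂ (F a) x₀ (x - x₀)‖ ≤ 4 * M * (‖x - x₀‖ / δ) ^ 2 := by
    have h := Complex.dist_le_mul_div_pow_of_mapsTo_ball_of_isLittleO (n := 1) (R₂ := 4 * M)
      (f := fun x => F a x - fderiv ℂ (F a) x₀ (x - x₀)) ((hF a).sub (by fun_prop))
      (fun y hy => ?_) ?_ hx
    · simpa [dist_eq_norm, sub_right_comm] using h
    · rw [Metric.mem_closedBall, dist_eq_norm, sub_self, map_zero, sub_zero]
      have h1 := hfdx a (y - x₀)
      have h2 : 2 * M / δ * ‖y - x₀‖ ≤ 2 * M := by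
        rw [div_mul_eq_mul_div, div_le_iff₀ hδ]
        exact mul_le_mul_of_nonneg_left (mem_ball_iff_norm.1 hy).le (by positivity)
      have h3 := norm_sub_le (F a y - fderiv ℂ (F a) x₀ (y - x₀)) (F a x₀)
      have h4 := norm_sub_le (F a y) (fderiv ℂ (F a) x₀ (y - x₀))
      linarith [hM a y hy, hM a x₀ hx₀]
    · simpa [sub_right_comm] using (hd a).isLittleO.norm_right
  have hquadG {x : E} (hx : x ∈ Metric.ball x₀ δ) :
      ‖G x - G x₀ - L' (x - x₀)‖ ≤ 4 * M * (‖x - x₀‖ / δ) ^ 2 :=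
    le_of_tendsto ((((hlim x hx).mono_left hul).sub ((hlim x₀ hx₀).mono_left hul)).sub
      (hL (x - x₀))).norm (Eventually.of_forall fun a => hquad a hx)
  refine HasFDerivAt.differentiableAt (f' := L') (HasFDerivAt.of_isLittleO ?_)
  have hO : (fun x => G x - G x₀ - L' (x - x₀)) =O[𝓝 x₀] fun x => ‖x - x₀‖ ^ 2 := by
    refine Asymptotics.IsBigO.of_bound (4 * M / δ ^ 2) ?_
    filter_upwards [Metric.ball_mem_nhds x₀ hδ] with x hx
    refine (hquadG hx).trans (le_of_eq ?_)
    rw [norm_pow, norm_norm, div_pow]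
    ring
  refine hO.trans_isLittleO ?_
  have h0 : Tendsto (fun x : E => ‖x - x₀‖) (𝓝 x₀) (𝓝 0) := by
    have : Continuous fun x : E => ‖x - x₀‖ := by fun_prop
    simpa using this.tendsto x₀
  have h1 := (Asymptotics.isLittleO_pow_id one_lt_two (𝕜 := ℝ)).comp_tendsto h0
  simpa [Function.comp_def] using h1.norm_right

lemma differentiableAt_tsum_of_sum_norm_le {E : Type*} [NormedAddCommGroup E] [NormedSpace ℂ E]
    {ι : Type*} {F : ι → E → ℂ} {x₀ : E} {δ B : ℝ} (hδ : 0 < δ)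
    (hF : ∀ i, Differentiable ℂ (F i))
    (hB : ∀ x ∈ Metric.ball x₀ δ, ∀ s : Finset ι, ∑ i ∈ s, ‖F i x‖ ≤ B) :
    DifferentiableAt ℂ (fun x => ∑' i, F i x) x₀ := by
  refine differentiableAt_of_tendsto_of_norm_le (l := atTop)
    (F := fun s : Finset ι => fun x => ∑ i ∈ s, F i x) hδ (fun s => ?_)
    (fun s x hx => (norm_sum_le _ _).trans (hB x hx s)) fun x hx => ?_
  · exact (Differentiable.fun_sum fun i _ => hF i).differentiableOn
  · exact (summable_of_sum_le (fun _ => norm_nonneg _) (hB x hx)).of_norm.hasSum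

/-- A continuous function on an open set is bounded on a uniform neighbourhood of each compact
subset, even when the ambient space is not locally compact. -/
lemma IsCompact.exists_norm_le_of_dist_lt {E : Type*} [PseudoMetricSpace E] {U K : Set E}
    {f : E → ℂ} (hK : IsCompact K) (hU : IsOpen U) (hKU : K ⊆ U) (hf : ContinuousOn f U) :
    ∃ δ > 0, ∃ M, ∀ x ∈ K, ∀ y, dist y x < δ → y ∈ U ∧ ‖f y‖ ≤ M := by
  obtain ⟨M, hM⟩ := (hK.image_of_continuousOn (hf.mono hKU).norm).bddAbove
  have hV : IsOpen (U ∩ (fun y => ‖f y‖) ⁻¹' Set.Iio (M + 1)) :=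
    hf.norm.isOpen_inter_preimage hU isOpen_Iio
  obtain ⟨δ, hδ, h⟩ := hK.exists_thickening_subset_open hV fun x hx =>
    ⟨hKU hx, (hM ⟨x, hx, rfl⟩).trans_lt (lt_add_one M)⟩
  refine ⟨δ, hδ, M + 1, fun x hx y hy => ?_⟩
  have := h (Metric.mem_thickening_iff.2 ⟨x, hx, hy⟩)
  exact ⟨this.1, le_of_lt this.2⟩

/-! ### Fourier series on the infinite torus -/

/-- The infinite torus, a compact abelian group. -/
abbrev InfTorus : Type := ℕ → Circle

noncomputable instance : MeasurableSpace InfTorus := borel InfTorus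

instance : BorelSpace InfTorus := ⟨rfl⟩

/-- The Haar probability measure of the infinite torus. -/
noncomputable def torusHaar : Measure InfTorus := Measure.haarMeasure ⊤

instance : Measure.IsHaarMeasure torusHaar := by unfold torusHaar; infer_instance

instance : IsProbabilityMeasure torusHaar := by
  constructor
  have := Measure.haarMeasure_self (K₀ := (⊤ : TopologicalSpace.PositiveCompacts InfTorus))
  simpa [torusHaar] using this

/-- The character `ω ↦ ∏ n, ω n ^ k n` of the infinite torus. -/
noncomputable def torusChar (k : ℕ →₀ ℤ) : C(InfTorus, ℂ) where
  toFun ω := ((k.prod fun n j => ω n ^ j : Circle) : ℂ)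
  continuous_toFun := by
    unfold Finsupp.prod
    fun_prop

lemma torusChar_apply (k : ℕ →₀ ℤ) (ω : InfTorus) :
    torusChar k ω = ((k.prod fun n j => ω n ^ j : Circle) : ℂ) := rfl

lemma torusChar_zero : torusChar 0 = 1 := by ext; simp [torusChar_apply]

lemma torusChar_add (k l : ℕ →₀ ℤ) : torusChar (k + l) = torusChar k * torusChar l := by
  ext ω
  rw [ContinuousMap.mul_apply, torusChar_apply, torusChar_apply, torusChar_apply,
    Finsupp.prod_add_index' (by simp) (fun n a b => zpow_add _ _ _), Circle.coe_mul]

lemma torusChar_mul (k : ℕ →₀ ℤ) (η ω : InfTorus) :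
    torusChar k (η * ω) = torusChar k η * torusChar k ω := by
  simp only [torusChar_apply, Pi.mul_apply, mul_zpow, ← Circle.coe_mul, Finsupp.prod_mul]

lemma norm_torusChar (k : ℕ →₀ ℤ) (ω : InfTorus) : ‖torusChar k ω‖ = 1 :=
  Circle.norm_coe _

lemma torusChar_one (k : ℕ →₀ ℤ) : torusChar k 1 = 1 := by
  simp [torusChar_apply, Finsupp.prod]

lemma torusChar_neg_mul (k : ℕ →₀ ℤ) (ω : InfTorus) : torusChar (-k) ω * torusChar k ω = 1 := by
  rw [← ContinuousMap.mul_apply, ← torusChar_add, neg_add_cancel, torusChar_zero]; rfl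

lemma star_torusChar (k : ℕ →₀ ℤ) : star (torusChar k) = torusChar (-k) := by
  ext ω
  have h : torusChar k ω ≠ 0 := norm_ne_zero_iff.1 (by simp [norm_torusChar])
  refine mul_right_cancel₀ h ?_
  rw [torusChar_neg_mul, ContinuousMap.star_apply, Complex.star_def, mul_comm, Complex.mul_conj,
    Complex.normSq_eq_norm_sq, norm_torusChar]
  simp

lemma torusChar_single (n : ℕ) (j : ℤ) (ω : InfTorus) :
    torusChar (Finsupp.single n j) ω = (ω n : ℂ) ^ j := by
  simp [torusChar_apply, Finsupp.prod_single_index]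

lemma torusChar_update_one (k : ℕ →₀ ℤ) (n : ℕ) (z : Circle) :
    torusChar k (Function.update 1 n z) = (z : ℂ) ^ k n := by
  rw [torusChar_apply, ← Circle.coe_zpow, Finsupp.prod]
  congr 1
  by_cases hn : n ∈ k.support
  · rw [Finset.prod_eq_single n (fun m _ hm => by simp [hm]) (fun h => (h hn).elim)]
    simp only [Function.update_self]
    rfl
  · rw [Finset.prod_eq_one fun m hm => ?_]
    · rw [Finsupp.notMem_support_iff.1 hn, zpow_zero]
    · have : m ≠ n := fun h => hn (h ▸ hm)
      simp [this]

lemma integral_torusChar {k : ℕ →₀ ℤ} (hk : k ≠ 0) : ∫ ω, torusChar k ω ∂torusHaar = 0 := by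
  obtain ⟨n, hn⟩ := Finsupp.ne_iff.1 hk
  rw [Finsupp.zero_apply] at hn
  obtain ⟨z, hz⟩ : ∃ z : Circle, (z : ℂ) ^ k n ≠ 1 := by
    refine ⟨Circle.exp (Real.pi / k n), ?_⟩
    have : (Circle.exp (Real.pi / k n)) ^ k n = Circle.exp Real.pi := by
      rw [← Circle.exp_zsmul]
      congr 1
      have : (k n : ℝ) ≠ 0 := by exact_mod_cast hn
      simp; field_simp
    rw [← Circle.coe_zpow, this]
    simp [Circle.coe_exp]
    norm_num
  have h := integral_mul_left_eq_self (μ := torusHaar) (fun ω => torusChar k ω)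
    (Function.update 1 n z)
  simp only [torusChar_mul, integral_const_mul, torusChar_update_one] at h
  have h' : ((z : ℂ) ^ k n - 1) * ∫ ω, torusChar k ω ∂torusHaar = 0 := by
    rw [sub_mul, h]; ring
  exact (mul_eq_zero.1 h').resolve_left (sub_ne_zero.2 hz)

lemma ContinuousMap.integrable_torusHaar (u : C(InfTorus, ℂ)) : Integrable u torusHaar :=
  u.continuous.integrable_of_hasCompactSupport (HasCompactSupport.of_compactSpace _)

lemma span_torusChar_topologicalClosure :
    (Submodule.span ℂ (Set.range torusChar)).topologicalClosure = ⊤ := by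
  let A : StarSubalgebra ℂ C(InfTorus, ℂ) :=
    { toSubalgebra := Algebra.adjoin ℂ (Set.range torusChar)
      star_mem' := by
        change Algebra.adjoin ℂ (Set.range torusChar)
          ≤ star (Algebra.adjoin ℂ (Set.range torusChar))
        refine Algebra.adjoin_le ?_
        rintro _ ⟨k, rfl⟩
        exact Algebra.subset_adjoin ⟨-k, (star_torusChar k).symm⟩ }
  have hA : A.toSubalgebra.toSubmodule = Submodule.span ℂ (Set.range torusChar) := by
    apply Algebra.adjoin_eq_span_of_subset
    refine .trans (fun x ↦ Submonoid.closure_induction (fun _ ↦ id) ⟨0, torusChar_zero⟩ ?_)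
      Submodule.subset_span
    rintro _ _ _ _ ⟨m, rfl⟩ ⟨n, rfl⟩
    exact ⟨m + n, torusChar_add m n⟩
  have hsep : A.SeparatesPoints := by
    intro x y hxy
    obtain ⟨i, hi⟩ := Function.ne_iff.1 hxy
    refine ⟨_, ⟨torusChar (Finsupp.single i 1), Algebra.subset_adjoin ⟨_, rfl⟩, rfl⟩, ?_⟩
    intro h
    change torusChar _ x = torusChar _ y at h
    rw [torusChar_single, torusChar_single, zpow_one, zpow_one] at h
    exact hi (Circle.coe_injective h)
  rw [← hA]
  exact congr_arg (Subalgebra.toSubmodule <| StarSubalgebra.toSubalgebra ·)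
    (ContinuousMap.starSubalgebra_topologicalClosure_eq_top_of_separatesPoints A hsep)

/-- Integration against a continuous function `u` with respect to Haar measure, as a continuous
linear functional. -/
noncomputable def torusPairing (u : C(InfTorus, ℂ)) : C(InfTorus, ℂ) →L[ℂ] ℂ :=
  LinearMap.mkContinuous
    { toFun := fun v => ∫ ω, v ω * u ω ∂torusHaar
      map_add' := fun x y => by
        simp only [ContinuousMap.add_apply, add_mul]
        exact integral_add (x * u).integrable_torusHaar (y * u).integrable_torusHaar
      map_smul' := fun a x => by
        simp only [ContinuousMap.smul_apply, smul_eq_mul, mul_assoc, RingHom.id_apply]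
        exact integral_const_mul _ _ } ‖u‖ fun v => by
    have := norm_integral_le_of_norm_le_const (μ := torusHaar) (f := fun ω => v ω * u ω)
      (C := ‖u‖ * ‖v‖) (Eventually.of_forall fun ω => by
        rw [norm_mul, mul_comm]
        gcongr
        · exact u.norm_coe_le_norm ω
        · exact v.norm_coe_le_norm ω)
    simpa using this

lemma torusPairing_apply (u v : C(InfTorus, ℂ)) :
    torusPairing u v = ∫ ω, v ω * u ω ∂torusHaar := rfl

lemma eq_zero_of_integral_mul_torusChar_eq_zero {u : C(InfTorus, ℂ)}
    (h : ∀ k, ∫ ω, torusChar k ω * u ω ∂torusHaar = 0) : u = 0 := by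
  have hall (v : C(InfTorus, ℂ)) : torusPairing u v = 0 := by
    have hv : v ∈ (Submodule.span ℂ (Set.range torusChar)).topologicalClosure := by
      rw [span_torusChar_topologicalClosure]; trivial
    have hle : (Submodule.span ℂ (Set.range torusChar)).topologicalClosure
        ≤ (torusPairing u).ker := by
      refine Submodule.topologicalClosure_minimal _ (Submodule.span_le.2 ?_)
        (torusPairing u).isClosed_ker
      rintro _ ⟨k, rfl⟩
      exact h k
    exact hle hv
  have h2 : ∫ ω, ‖u ω‖ ^ 2 ∂torusHaar = 0 := by
    have := hall (star u)
    simp only [torusPairing_apply, ContinuousMap.star_apply, Complex.star_def,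
      mul_comm _ (u _), Complex.mul_conj, Complex.normSq_eq_norm_sq] at this
    rw [integral_complex_ofReal] at this
    exact_mod_cast this
  have hc : Continuous fun ω => ‖u ω‖ ^ 2 := by fun_prop
  have h3 : (fun ω => ‖u ω‖ ^ 2) = 0 :=
    (hc.ae_eq_iff_eq torusHaar continuous_zero).1
      ((integral_eq_zero_iff_of_nonneg (fun ω => by positivity)
        (hc.integrable_of_hasCompactSupport (HasCompactSupport.of_compactSpace _))).1 h2)
  ext ω
  simpa using congrFun h3 ω

/-- A continuous function on the infinite torus whose Fourier coefficients are summable is the sum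
of its Fourier series. -/
lemma hasSum_fourier_infTorus {u : C(InfTorus, ℂ)} {a : (ℕ →₀ ℤ) → ℂ} (ha : Summable a)
    (h : ∀ k, ∫ ω, torusChar (-k) ω * u ω ∂torusHaar = a k) : HasSum a (u 1) := by
  have hs : Summable fun k => a k • torusChar k := by
    refine Summable.of_norm_bounded ha.norm fun k => ?_
    rw [ContinuousMap.norm_le _ (norm_nonneg _)]
    intro ω
    simp [norm_torusChar]
  have hu : u = ∑' k, a k • torusChar k := by
    refine sub_eq_zero.1 (eq_zero_of_integral_mul_torusChar_eq_zero fun l => ?_)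
    have h1 := (torusPairing (torusChar l)).hasSum hs.hasSum
    have h2 : HasSum (fun k => torusPairing (torusChar l) (a k • torusChar k)) (a (-l)) := by
      have hp (k : ℕ →₀ ℤ) : torusPairing (torusChar l) (a k • torusChar k)
          = a k * ∫ ω, torusChar (k + l) ω ∂torusHaar := by
        rw [map_smul, torusPairing_apply, smul_eq_mul]
        simp only [torusChar_add, ContinuousMap.mul_apply]
      have h0 : torusPairing (torusChar l) (a (-l) • torusChar (-l)) = a (-l) := by
        rw [hp, neg_add_cancel, torusChar_zero]; simp
      have h2 := hasSum_single (f := fun k => torusPairing (torusChar l) (a k • torusChar k))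
        (-l) fun k hk => by
          rw [hp, integral_torusChar (fun h => hk (eq_neg_of_add_eq_zero_left h)), mul_zero]
      rwa [h0] at h2
    have h3 := h1.unique h2
    have h4 := h (-l)
    rw [neg_neg] at h4
    rw [torusPairing_apply] at h3
    simp only [ContinuousMap.sub_apply, mul_sub]
    have e := integral_sub (torusChar l * u).integrable_torusHaar
      (torusChar l * ∑' k, a k • torusChar k).integrable_torusHaar
    simp only [ContinuousMap.mul_apply] at e
    rw [e, h4, ← h3]
    simp only [mul_comm, sub_self]
  have h5 := (ContinuousMap.evalCLM ℂ (1 : InfTorus)).hasSum hs.hasSum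
  rw [← hu] at h5
  simpa [torusChar_one] using h5

/-! ### Coordinatewise scaling and compact sets in an `ℓ₁`-sum -/

section EllOne

variable {X : ℕ → Type*} [∀ n, NormedAddCommGroup (X n)]

lemma hasSum_norm_lp_one (x : lp X 1) : HasSum (fun n => ‖x n‖) ‖x‖ := by
  simpa using lp.hasSum_norm (p := 1) (by simp) x

lemma norm_lp_one_le_of_sum_le {x : lp X 1} {C : ℝ}
    (h : ∀ s : Finset ℕ, ∑ n ∈ s, ‖x n‖ ≤ C) : ‖x‖ ≤ C :=
  hasSum_le_of_sum_le (hasSum_norm_lp_one x) h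

lemma memℓp_one_of_summable {c : ∀ n, X n} (h : Summable fun n => ‖c n‖) : Memℓp c 1 :=
  memℓp_gen (by simpa using h)

variable [∀ n, NormedSpace ℂ (X n)]

open Classical in
/-- Multiplication of the `n`-th component of `x` by `z n`, for all `n`. The value is `0` if the
result is not in the `ℓ₁`-sum, which cannot happen when `z` is bounded. -/
noncomputable def coordScale (z : ℕ → ℂ) (x : lp X 1) : lp X 1 :=
  if h : Memℓp (fun n => z n • x n) 1 then ⟨_, h⟩ else 0

section Bounded

variable {z : ℕ → ℂ} {C : ℝ}

lemma coordScale_apply (hz : ∀ n, ‖z n‖ ≤ C) (x : lp X 1) (n : ℕ) :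
    coordScale z x n = z n • x n := by
  have h : Memℓp (fun n => z n • x n) 1 := by
    refine memℓp_one_of_summable (Summable.of_nonneg_of_le (fun n => norm_nonneg _) (fun n => ?_)
      ((hasSum_norm_lp_one x).summable.mul_left C))
    rw [norm_smul]
    exact mul_le_mul_of_nonneg_right (hz n) (norm_nonneg _)
  rw [coordScale, dif_pos h]

lemma norm_coordScale_le (hz : ∀ n, ‖z n‖ ≤ C) (x : lp X 1) : ‖coordScale z x‖ ≤ C * ‖x‖ := by
  refine hasSum_le (fun n => ?_) (hasSum_norm_lp_one (coordScale z x)) ((hasSum_norm_lp_one x).mul_left C)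
  rw [coordScale_apply hz, norm_smul]
  exact mul_le_mul_of_nonneg_right (hz n) (norm_nonneg _)

lemma norm_coordScale_le_norm (hz : ∀ n, ‖z n‖ ≤ 1) (x : lp X 1) : ‖coordScale z x‖ ≤ ‖x‖ := by
  simpa using norm_coordScale_le hz x

lemma isBoundedLinearMap_coordScale (hz : ∀ n, ‖z n‖ ≤ C) :
    IsBoundedLinearMap ℂ (coordScale z : lp X 1 → lp X 1) := by
  refine IsLinearMap.with_bound ⟨fun x y => ?_, fun c x => ?_⟩ C (norm_coordScale_le hz)
  · ext n
    simp [coordScale_apply hz]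
  · ext n
    rw [lp.coeFn_smul, Pi.smul_apply, coordScale_apply hz, coordScale_apply hz, lp.coeFn_smul,
      Pi.smul_apply, smul_comm]

lemma coordScale_smul (hz : ∀ n, ‖z n‖ ≤ C) (c : ℂ) (x : lp X 1) :
    coordScale z (c • x) = c • coordScale z x :=
  (isBoundedLinearMap_coordScale hz).map_smul c x

end Bounded

lemma coordScale_mul {z w : ℕ → ℂ} {C D : ℝ} (hz : ∀ n, ‖z n‖ ≤ C) (hw : ∀ n, ‖w n‖ ≤ D)
    (x : lp X 1) : coordScale (z * w) x = coordScale z (coordScale w x) := by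
  have hzw (n : ℕ) : ‖(z * w) n‖ ≤ C * D := by
    rw [Pi.mul_apply, norm_mul]
    exact mul_le_mul (hz n) (hw n) (norm_nonneg _) ((norm_nonneg _).trans (hz n))
  ext n
  rw [coordScale_apply hzw, coordScale_apply hz, coordScale_apply hw, Pi.mul_apply, mul_smul]

lemma coordScale_const (c : ℂ) (x : lp X 1) : coordScale (fun _ => c) x = c • x := by
  ext n
  rw [coordScale_apply (C := ‖c‖) (fun _ => le_rfl), lp.coeFn_smul, Pi.smul_apply]

lemma coordScale_one (x : lp X 1) : coordScale 1 x = x :=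
  (coordScale_const 1 x).trans (one_smul ℂ x)

lemma norm_update_one_le {n : ℕ} {ζ : ℂ} {C : ℝ} (hC : 1 ≤ C) (hζ : ‖ζ‖ ≤ C) (m : ℕ) :
    ‖Function.update (1 : ℕ → ℂ) n ζ m‖ ≤ C := by
  rcases eq_or_ne m n with rfl | h
  · simpa using hζ
  · simpa [h] using hC

lemma coordScale_update_one (n : ℕ) (ζ : ℂ) (x : lp X 1) :
    coordScale (Function.update 1 n ζ) x = x + (ζ - 1) • lp.single 1 n (x n) := by
  ext m
  rw [coordScale_apply (norm_update_one_le (le_max_left 1 ‖ζ‖) (le_max_right _ _)),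
    lp.coeFn_add, Pi.add_apply, lp.coeFn_smul, Pi.smul_apply]
  rcases eq_or_ne m n with rfl | h
  · simp [sub_smul]
  · simp [h]

/-- Scaling of a fixed vector by multipliers of modulus at most `1` is continuous for pointwise
convergence of the multipliers. -/
lemma tendsto_coordScale {α : Type*} {l : Filter α} {z : α → ℕ → ℂ} {z₀ : ℕ → ℂ} (x : lp X 1)
    (hz : ∀ a n, ‖z a n‖ ≤ 1) (hz₀ : ∀ n, ‖z₀ n‖ ≤ 1)
    (h : ∀ n, Tendsto (fun a => z a n) l (𝓝 (z₀ n))) :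
    Tendsto (fun a => coordScale (z a) x) l (𝓝 (coordScale z₀ x)) := by
  rw [tendsto_iff_norm_sub_tendsto_zero]
  have hn (a : α) : ‖coordScale (z a) x - coordScale z₀ x‖ = ∑' n, ‖z a n - z₀ n‖ * ‖x n‖ := by
    rw [← (hasSum_norm_lp_one (coordScale (z a) x - coordScale z₀ x)).tsum_eq]
    refine tsum_congr fun n => ?_
    rw [lp.coeFn_sub, Pi.sub_apply, coordScale_apply (hz a), coordScale_apply hz₀, ← sub_smul,
      norm_smul]
  simp_rw [hn]
  have h0 : (0 : ℝ) = ∑' n : ℕ, (0 : ℝ) := by simp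
  rw [h0]
  refine tendsto_tsum_of_dominated_convergence ((hasSum_norm_lp_one x).summable.mul_left 2)
    (fun n => ?_) (Eventually.of_forall fun a n => ?_)
  · have := ((tendsto_iff_norm_sub_tendsto_zero.1 (h n))).mul_const ‖x n‖
    simpa using this
  · rw [Real.norm_of_nonneg (by positivity)]
    gcongr
    linarith [norm_sub_le (z a n) (z₀ n), hz a n, hz₀ n]

/-- The rotation of `x` by an element of the infinite torus. -/
noncomputable def torusAct (ω : InfTorus) (x : lp X 1) : lp X 1 :=
  coordScale (fun n => (ω n : ℂ)) x

lemma norm_torus_apply_le (ω : InfTorus) (n : ℕ) : ‖(ω n : ℂ)‖ ≤ 1 := (Circle.norm_coe _).le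

lemma norm_torusAct_le (ω : InfTorus) (x : lp X 1) : ‖torusAct ω x‖ ≤ ‖x‖ :=
  norm_coordScale_le_norm (norm_torus_apply_le ω) x

lemma torusAct_one (x : lp X 1) : torusAct 1 x = x :=
  coordScale_one x

lemma torusAct_mul (ω η : InfTorus) (x : lp X 1) :
    torusAct (ω * η) x = torusAct ω (torusAct η x) := by
  rw [torusAct, torusAct, torusAct,
    ← coordScale_mul (norm_torus_apply_le ω) (norm_torus_apply_le η)]
  rfl

lemma isBoundedLinearMap_torusAct (ω : InfTorus) :
    IsBoundedLinearMap ℂ (torusAct ω : lp X 1 → lp X 1) :=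
  isBoundedLinearMap_coordScale (norm_torus_apply_le ω)

lemma continuous_torusAct (x : lp X 1) : Continuous fun ω : InfTorus => torusAct ω x :=
  continuous_iff_continuousAt.2 fun ω₀ => tendsto_coordScale x norm_torus_apply_le
    (norm_torus_apply_le ω₀) fun n =>
      (continuous_subtype_val.comp (continuous_apply n)).continuousAt

/-- In an `ℓ₁`-sum of finite-dimensional spaces the weighted unit ball `∑ ‖y n‖ / σ n ≤ 1` is
compact as soon as `σ n → 0`: it is the continuous image of a closed subset of a product of
closed unit balls. -/
lemma isCompact_setOf_sum_norm_div_le [∀ n, FiniteDimensional ℂ (X n)] {σ : ℕ → ℝ}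
    (hσ : ∀ n, 0 < σ n) (hσ0 : Tendsto σ atTop (𝓝 0)) :
    IsCompact {y : lp X 1 | ∀ s : Finset ℕ, ∑ n ∈ s, ‖y n‖ / σ n ≤ 1} := by
  classical
  have (n : ℕ) : ProperSpace (X n) := FiniteDimensional.proper ℂ (X n)
  let Q : Set (∀ n, X n) := {c | ∀ s : Finset ℕ, ∑ n ∈ s, ‖c n‖ ≤ 1}
  have hQ : IsCompact Q := by
    refine (isCompact_univ_pi fun n => isCompact_closedBall (0 : X n) 1).of_isClosed_subset ?_ ?_
    · have : Q = ⋂ s : Finset ℕ, {c | ∑ n ∈ s, ‖c n‖ ≤ 1} := by ext; simp [Q]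
      rw [this]
      exact isClosed_iInter fun s => isClosed_le (by fun_prop) continuous_const
    · intro c hc n _
      simpa using hc {n}
  obtain ⟨B, hB⟩ : ∃ B, ∀ n, σ n ≤ B := by
    obtain ⟨B, hB⟩ := hσ0.bddAbove_range
    exact ⟨B, fun n => hB ⟨n, rfl⟩⟩
  have hsum {c : ∀ n, X n} (hc : c ∈ Q) : Summable fun n => ‖c n‖ :=
    summable_of_sum_le (fun _ => norm_nonneg _) hc
  have hmem {c : ∀ n, X n} (hc : c ∈ Q) : Memℓp (fun n => (σ n : ℂ) • c n) 1 := by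
    refine memℓp_one_of_summable (Summable.of_nonneg_of_le (fun n => norm_nonneg _) (fun n => ?_)
      ((hsum hc).mul_left B))
    rw [norm_smul, Complex.norm_of_nonneg (hσ n).le]
    exact mul_le_mul_of_nonneg_right (hB n) (norm_nonneg _)
  let Φ : (∀ n, X n) → lp X 1 := fun c =>
    if h : Memℓp (fun n => (σ n : ℂ) • c n) 1 then ⟨_, h⟩ else 0
  have hΦ {c : ∀ n, X n} (hc : c ∈ Q) (n : ℕ) : Φ c n = (σ n : ℂ) • c n := by
    simp only [Φ, dif_pos (hmem hc)]
  have himage : {y : lp X 1 | ∀ s : Finset ℕ, ∑ n ∈ s, ‖y n‖ / σ n ≤ 1} = Φ '' Q := by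
    ext y
    constructor
    · intro hy
      have hc : (fun n => ((σ n : ℂ)⁻¹) • y n) ∈ Q := by
        intro s
        refine le_trans (le_of_eq (Finset.sum_congr rfl fun n _ => ?_)) (hy s)
        rw [norm_smul, norm_inv, Complex.norm_of_nonneg (hσ n).le]
        field_simp
      refine ⟨_, hc, ?_⟩
      ext n
      rw [hΦ hc, smul_inv_smul₀]
      exact_mod_cast (hσ n).ne'
    · rintro ⟨c, hc, rfl⟩ s
      refine le_trans (le_of_eq (Finset.sum_congr rfl fun n _ => ?_)) (hc s)
      have := (hσ n).ne'
      rw [hΦ hc, norm_smul, Complex.norm_of_nonneg (hσ n).le]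
      field_simp
  rw [himage]
  refine hQ.image_of_continuousOn fun c₀ hc₀ => ?_
  rw [ContinuousWithinAt, Metric.tendsto_nhds]
  intro ε hε
  obtain ⟨N, hN⟩ := eventually_atTop.1 (hσ0.eventually (Iio_mem_nhds (by positivity : 0 < ε / 8)))
  -- the first `N` components are handled by continuity, the remaining ones by smallness of `σ`
  have hcont : Continuous fun c : ∀ n, X n => ∑ n ∈ Finset.range N, σ n * ‖c n - c₀ n‖ := by
    fun_prop
  have hev : ∀ᶠ c in 𝓝[Q] c₀, ∑ n ∈ Finset.range N, σ n * ‖c n - c₀ n‖ < ε / 4 := by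
    refine (hcont.tendsto c₀).mono_left nhdsWithin_le_nhds |>.eventually (Iio_mem_nhds ?_)
    simp; positivity
  filter_upwards [hev, self_mem_nhdsWithin] with c hc hcQ
  rw [dist_eq_norm]
  refine lt_of_le_of_lt (norm_lp_one_le_of_sum_le (C := ε / 4 + ε / 8 * 2) fun s => ?_)
    (by linarith)
  have hterm (n : ℕ) : ‖(Φ c - Φ c₀) n‖ = σ n * ‖c n - c₀ n‖ := by
    rw [lp.coeFn_sub, Pi.sub_apply, hΦ hcQ, hΦ hc₀, ← smul_sub, norm_smul,
      Complex.norm_of_nonneg (hσ n).le]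
  simp_rw [hterm]
  rw [← Finset.sum_filter_add_sum_filter_not s (· < N)]
  refine add_le_add (le_trans ?_ hc.le) ?_
  · refine Finset.sum_le_sum_of_subset_of_nonneg (fun n hn => ?_) fun n _ _ =>
      mul_nonneg (hσ n).le (norm_nonneg _)
    simpa using (Finset.mem_filter.1 hn).2
  · calc ∑ n ∈ s with ¬ n < N, σ n * ‖c n - c₀ n‖
        ≤ ∑ n ∈ s with ¬ n < N, ε / 8 * (‖c n‖ + ‖c₀ n‖) := by
          refine Finset.sum_le_sum fun n hn => ?_
          have := hN n (not_lt.1 (Finset.mem_filter.1 hn).2)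
          exact mul_le_mul (le_of_lt this) (norm_sub_le _ _) (norm_nonneg _) (by positivity)
      _ = ε / 8 * (∑ n ∈ s with ¬ n < N, ‖c n‖ + ∑ n ∈ s with ¬ n < N, ‖c₀ n‖) := by
          rw [← Finset.mul_sum, Finset.sum_add_distrib]
      _ ≤ ε / 8 * 2 := by
          gcongr
          linarith [hcQ (s.filter (¬ · < N)), hc₀ (s.filter (¬ · < N))]

end EllOne

/-! ### Multihomogeneous components of a holomorphic function -/

section Components

variable {X : ℕ → Type*} [∀ n, NormedAddCommGroup (X n)] [∀ n, NormedSpace ℂ (X n)]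

/-- The Fourier coefficient of index `k` of `ω ↦ f (ω • x)` on the infinite torus. As a function
of `x` it is the component of `f` that has degree `k n` in the `n`-th variable for each `n`. -/
noncomputable def torusCoeff (f : lp X 1 → ℂ) (k : ℕ →₀ ℤ) (x : lp X 1) : ℂ :=
  ∫ ω, torusChar (-k) ω * f (torusAct ω x) ∂torusHaar

lemma torusCoeff_torusAct (f : lp X 1 → ℂ) (k : ℕ →₀ ℤ) (η : InfTorus) (x : lp X 1) :
    torusCoeff f k (torusAct η x) = torusChar k η * torusCoeff f k x := by
  have h := integral_mul_right_eq_self (μ := torusHaar)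
    (fun ω => torusChar (-k) ω * f (torusAct ω x)) η
  have h' : torusChar (-k) η * torusCoeff f k (torusAct η x) = torusCoeff f k x := by
    rw [torusCoeff, torusCoeff, ← h, ← integral_const_mul]
    congr 1
    ext ω
    rw [torusChar_mul, torusAct_mul]
    ring
  rw [← h', ← mul_assoc, mul_comm (torusChar k η), torusChar_neg_mul, one_mul]

lemma norm_torusCoeff_le {f : lp X 1 → ℂ} {x : lp X 1} {M : ℝ}
    (h : ∀ ω, ‖f (torusAct ω x)‖ ≤ M) (k : ℕ →₀ ℤ) : ‖torusCoeff f k x‖ ≤ M := by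
  have := norm_integral_le_of_norm_le_const (μ := torusHaar)
    (f := fun ω => torusChar (-k) ω * f (torusAct ω x)) (C := M) (Eventually.of_forall fun ω => by
      rw [norm_mul, norm_torusChar, one_mul]
      exact h ω)
  simpa [torusCoeff] using this

variable {f : lp X 1 → ℂ} {R : ℝ}

lemma torusAct_mem_ball {x : lp X 1} (hx : x ∈ Metric.ball 0 R) (ω : InfTorus) :
    torusAct ω x ∈ Metric.ball 0 R := by
  rw [mem_ball_zero_iff] at hx ⊢
  exact (norm_torusAct_le ω x).trans_lt hx

lemma continuous_comp_torusAct (hf : DifferentiableOn ℂ f (Metric.ball 0 R)) {x : lp X 1}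
    (hx : x ∈ Metric.ball 0 R) : Continuous fun ω => f (torusAct ω x) :=
  hf.continuousOn.comp_continuous (continuous_torusAct x) (torusAct_mem_ball hx)

lemma differentiableOn_torusCoeff (hf : DifferentiableOn ℂ f (Metric.ball 0 R)) (k : ℕ →₀ ℤ) :
    DifferentiableOn ℂ (torusCoeff f k) (Metric.ball 0 R) := by
  intro x₀ hx₀
  obtain ⟨δ, hδ, M, hM⟩ := (isCompact_range (continuous_torusAct x₀)).exists_norm_le_of_dist_lt
    Metric.isOpen_ball (Set.range_subset_iff.2 (torusAct_mem_ball hx₀)) hf.continuousOn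
  have hM' (ω : InfTorus) (x : lp X 1) (hx : x ∈ Metric.ball x₀ δ) :
      torusAct ω x ∈ Metric.ball 0 R ∧ ‖f (torusAct ω x)‖ ≤ M := by
    refine hM _ ⟨ω, rfl⟩ _ (lt_of_le_of_lt ?_ hx)
    rw [dist_eq_norm, dist_eq_norm, ← (isBoundedLinearMap_torusAct ω).map_sub]
    exact norm_torusAct_le _ _
  refine (differentiableAt_integral_of_norm_le (M := M) (lt_min hδ (sub_pos.2 hx₀))
    (fun ω => ?_) (fun ω x hx => ?_) (fun x hx => ?_)).differentiableWithinAt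
  · refine (hf.comp (isBoundedLinearMap_torusAct ω).differentiable.differentiableOn
      fun x hx => ?_).const_mul _
    exact (hM' ω x (Metric.ball_subset_ball (min_le_left _ _) hx)).1
  · rw [norm_mul, norm_torusChar, one_mul]
    exact (hM' ω x (Metric.ball_subset_ball (min_le_left _ _) hx)).2
  · have hx' : x ∈ Metric.ball 0 R := by
      rw [Metric.mem_ball] at hx ⊢
      linarith [dist_triangle x x₀ 0, min_le_right δ (R - dist x₀ 0)]
    exact ((torusChar (-k)).continuous.mul (continuous_comp_torusAct hf hx')).aestronglyMeasurable

lemma coordScale_update_mem_ball {x : lp X 1} (hx : x ∈ Metric.ball 0 R) (n : ℕ) {ζ : ℂ}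
    (hζ : ‖ζ‖ ≤ 1) : coordScale (Function.update 1 n ζ) x ∈ Metric.ball 0 R := by
  rw [mem_ball_zero_iff] at hx ⊢
  exact (norm_coordScale_le_norm (norm_update_one_le le_rfl hζ) x).trans_lt hx

lemma diffContOnCl_torusCoeff_update (hf : DifferentiableOn ℂ f (Metric.ball 0 R)) (k : ℕ →₀ ℤ)
    {x : lp X 1} (hx : x ∈ Metric.ball 0 R) (n : ℕ) :
    DiffContOnCl ℂ (fun ζ => torusCoeff f k (coordScale (Function.update 1 n ζ) x))
      (Metric.ball 0 1) := by
  apply DifferentiableOn.diffContOnCl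
  rw [closure_ball 0 one_ne_zero]
  refine (differentiableOn_torusCoeff hf k).comp ?_ fun ζ hζ =>
    coordScale_update_mem_ball hx n (by simpa using hζ)
  simp_rw [coordScale_update_one]
  fun_prop

lemma torusCoeff_update_of_norm_eq_one (k : ℕ →₀ ℤ) (x : lp X 1) (n : ℕ) {ζ : ℂ}
    (hζ : ‖ζ‖ = 1) :
    torusCoeff f k (coordScale (Function.update 1 n ζ) x) = ζ ^ k n * torusCoeff f k x := by
  obtain ⟨ζ, rfl⟩ : ∃ z : Circle, (z : ℂ) = ζ := ⟨⟨ζ, mem_sphere_zero_iff_norm.2 hζ⟩, rfl⟩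
  have h := torusCoeff_torusAct f k (Function.update 1 n ζ) x
  rw [torusChar_update_one] at h
  rw [← h, torusAct]
  congr 2
  ext m
  rcases eq_or_ne m n with rfl | hm
  · simp
  · simp [hm]

/-- Scaling one variable by `ζ` in the closed unit disc multiplies the component of index `k` by
`ζ ^ k n`: this holds for `‖ζ‖ = 1` by invariance of Haar measure and extends by the maximum
modulus principle. -/
lemma torusCoeff_update (hf : DifferentiableOn ℂ f (Metric.ball 0 R)) {k : ℕ →₀ ℤ}
    {x : lp X 1} (hx : x ∈ Metric.ball 0 R) {n j : ℕ} (hj : k n = j) {ζ : ℂ} (hζ : ‖ζ‖ ≤ 1) :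
    torusCoeff f k (coordScale (Function.update 1 n ζ) x) = ζ ^ j * torusCoeff f k x := by
  refine Complex.eqOn_closure_of_eqOn_frontier (Metric.isBounded_ball (x := (0 : ℂ)) (r := 1))
    (diffContOnCl_torusCoeff_update hf k hx n)
    (g := fun ζ => ζ ^ j * torusCoeff f k x) ?_ (fun z hz => ?_) ?_
  · exact Differentiable.diffContOnCl (by fun_prop)
  · rw [frontier_ball 0 one_ne_zero, mem_sphere_zero_iff_norm] at hz
    simp only [torusCoeff_update_of_norm_eq_one k x n hz, hj, zpow_natCast]
  · rw [closure_ball 0 one_ne_zero]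
    simpa using hζ

lemma torusCoeff_eq_zero_of_neg (hf : DifferentiableOn ℂ f (Metric.ball 0 R)) {k : ℕ →₀ ℤ}
    {x : lp X 1} (hx : x ∈ Metric.ball 0 R) {n : ℕ} (hn : k n < 0) : torusCoeff f k x = 0 := by
  obtain ⟨j, hj⟩ := Int.exists_eq_neg_ofNat hn.le
  have hj0 : j ≠ 0 := by rintro rfl; simp [hj] at hn
  -- `ζ ^ j` times the scaled component is constant on the unit circle and vanishes at `0`
  have h := Complex.eqOn_closure_of_eqOn_frontier
    (f := fun ζ : ℂ => ζ ^ j • torusCoeff f k (coordScale (Function.update 1 n ζ) x))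
    (g := fun _ => torusCoeff f k x)
    (Metric.isBounded_ball (x := (0 : ℂ)) (r := 1))
    (DiffContOnCl.smul (Differentiable.diffContOnCl (by fun_prop))
      (diffContOnCl_torusCoeff_update hf k hx n)) diffContOnCl_const fun ζ hζ => by
        rw [frontier_ball 0 one_ne_zero, mem_sphere_zero_iff_norm] at hζ
        have hζ0 : ζ ≠ 0 := norm_ne_zero_iff.1 (by simp [hζ])
        simp only [torusCoeff_update_of_norm_eq_one k x n hζ, hj, smul_eq_mul, zpow_neg,
          zpow_natCast]
        rw [mul_inv_cancel_left₀ (pow_ne_zero _ hζ0)]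
  have h0 := h (x := 0) (subset_closure (by simp))
  simpa [hj0] using h0.symm

/-- A multi-index with natural exponents, as a character of the infinite torus. -/
noncomputable def intIndex (k : ℕ →₀ ℕ) : ℕ →₀ ℤ := 
  k.mapRange (Nat.cast : ℕ → ℤ) Nat.cast_zero

lemma intIndex_apply (k : ℕ →₀ ℕ) (n : ℕ) : intIndex k n = (k n : ℤ) := rfl

lemma intIndex_injective : Function.Injective intIndex :=
  Finsupp.mapRange_injective _ Nat.cast_zero Nat.cast_injective

/-- The monomial `∏ n, z n ^ k n`. -/
noncomputable def monomialValue {A : Type*} [CommMonoid A] (k : ℕ →₀ ℕ) (z : ℕ → A) : A :=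
  k.prod fun n j => z n ^ j

lemma monomialValue_mul {A : Type*} [CommMonoid A] (k : ℕ →₀ ℕ) (z w : ℕ → A) :
    monomialValue k (z * w) = monomialValue k z * monomialValue k w := by
  simp [monomialValue, mul_pow, Finsupp.prod_mul]

lemma monomialValue_const {A : Type*} [CommMonoid A] (k : ℕ →₀ ℕ) (c : A) :
    monomialValue k (fun _ => c) = c ^ k.degree := by
  rw [monomialValue, Finsupp.prod, Finset.prod_pow_eq_pow_sum]; rfl

lemma torusCoeff_coordScale (hf : DifferentiableOn ℂ f (Metric.ball 0 R)) (k : ℕ →₀ ℕ)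
    {x : lp X 1} (hx : x ∈ Metric.ball 0 R) {z : ℕ → ℂ} (hz : ∀ n, ‖z n‖ ≤ 1) :
    torusCoeff f (intIndex k) (coordScale z x)
      = monomialValue k z * torusCoeff f (intIndex k) x := by
  classical
  let Z : Finset ℕ → ℕ → ℂ := fun S n => if n ∈ S then z n else 1
  have hZ (S : Finset ℕ) (n : ℕ) : ‖Z S n‖ ≤ 1 := by
    by_cases h : n ∈ S
    · simpa [Z, h] using hz n
    · simp [Z, h]
  have hmem {w : ℕ → ℂ} (hw : ∀ n, ‖w n‖ ≤ 1) : coordScale w x ∈ Metric.ball 0 R := by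
    rw [mem_ball_zero_iff] at hx ⊢
    exact (norm_coordScale_le_norm hw x).trans_lt hx
  have hfin (S : Finset ℕ) : torusCoeff f (intIndex k) (coordScale (Z S) x)
      = (∏ n ∈ S, z n ^ k n) * torusCoeff f (intIndex k) x := by
    induction S using Finset.induction_on with
    | empty =>
      have : Z ∅ = 1 := by ext; simp [Z]
      rw [this, coordScale_one]; simp
    | insert n S hn ih =>
      have : Z (insert n S) = Function.update (1 : ℕ → ℂ) n (z n) * Z S := by
        ext m
        rcases eq_or_ne m n with rfl | hm
        · simp [Z, hn]
        · simp [Z, hm]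
      rw [this, coordScale_mul (norm_update_one_le le_rfl (hz n)) (hZ S),
        torusCoeff_update hf (hmem (hZ S)) (intIndex_apply k n) (hz n), ih,
        Finset.prod_insert hn, mul_assoc]
  have hlim : Tendsto (fun S => coordScale (Z S) x) atTop (𝓝 (coordScale z x)) := by
    refine tendsto_coordScale x hZ hz fun n => tendsto_const_nhds.congr' ?_
    filter_upwards [eventually_ge_atTop {n}] with S hS
    have : n ∈ S := hS (Finset.mem_singleton_self n)
    simp [Z, this]
  have h1 : Tendsto (fun S => torusCoeff f (intIndex k) (coordScale (Z S) x)) atTop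
      (𝓝 (torusCoeff f (intIndex k) (coordScale z x))) :=
    ((differentiableOn_torusCoeff hf _).continuousOn.continuousAt
      (Metric.isOpen_ball.mem_nhds (hmem hz))).tendsto.comp hlim
  refine tendsto_nhds_unique h1 (tendsto_const_nhds.congr' ?_)
  filter_upwards [eventually_ge_atTop k.support] with S hS
  rw [hfin, monomialValue, Finsupp.prod_of_support_subset k hS _ (by simp)]

lemma torusCoeff_smul (hf : DifferentiableOn ℂ f (Metric.ball 0 R)) (k : ℕ →₀ ℕ)
    {x : lp X 1} (hx : x ∈ Metric.ball 0 R) {c : ℂ} (hc : ‖c‖ ≤ 1) :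
    torusCoeff f (intIndex k) (c • x) = c ^ k.degree * torusCoeff f (intIndex k) x := by
  rw [← coordScale_const, torusCoeff_coordScale hf k hx (fun _ => hc), monomialValue_const]

/-- The component of index `k` of a holomorphic function on the ball of radius `R`, extended to the
whole space by homogeneity. -/
noncomputable def component (f : lp X 1 → ℂ) (R : ℝ) (k : ℕ →₀ ℕ) (x : lp X 1) : ℂ :=
  (((R / (R + ‖x‖) : ℝ) : ℂ) ^ k.degree)⁻¹ *
    torusCoeff f (intIndex k) (((R / (R + ‖x‖) : ℝ) : ℂ) • x)

lemma torusCoeff_smul_eq_component (hR : 0 < R) (hf : DifferentiableOn ℂ f (Metric.ball 0 R))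
    (k : ℕ →₀ ℕ) {x : lp X 1} {c : ℝ} (hc : 0 < c) (hx : c * ‖x‖ < R) :
    torusCoeff f (intIndex k) ((c : ℂ) • x) = (c : ℂ) ^ k.degree * component f R k x := by
  have key {a b : ℝ} (ha : 0 < a) (hab : a ≤ b) (hb : b * ‖x‖ < R) :
      ((a : ℂ) ^ k.degree)⁻¹ * torusCoeff f (intIndex k) ((a : ℂ) • x)
        = ((b : ℂ) ^ k.degree)⁻¹ * torusCoeff f (intIndex k) ((b : ℂ) • x) := by
    have hb0 : 0 < b := ha.trans_le hab
    have ha' : (a : ℂ) ≠ 0 := by exact_mod_cast ha.ne'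
    have hb' : (b : ℂ) ≠ 0 := by exact_mod_cast hb0.ne'
    have h := torusCoeff_smul hf k (x := (b : ℂ) • x) (c := ((a / b : ℝ) : ℂ))
      (by rwa [mem_ball_zero_iff, norm_smul, Complex.norm_of_nonneg hb0.le])
      (by rw [Complex.norm_of_nonneg (by positivity)]; exact (div_le_one hb0).2 hab)
    rw [smul_smul, ← Complex.ofReal_mul, div_mul_cancel₀ _ hb0.ne'] at h
    rw [h, Complex.ofReal_div, div_pow]
    field_simp
  have hx0 := norm_nonneg x
  have hc1 : 0 < R / (R + ‖x‖) := by positivity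
  have hc1x : R / (R + ‖x‖) * ‖x‖ < R := by
    rw [div_mul_eq_mul_div, div_lt_iff₀ (by positivity)]
    nlinarith
  have h : ((c : ℂ) ^ k.degree)⁻¹ * torusCoeff f (intIndex k) ((c : ℂ) • x)
      = component f R k x := by
    rcases le_total c (R / (R + ‖x‖)) with h | h
    · exact key hc h hc1x
    · exact (key hc1 h hx).symm
  rw [← h, mul_inv_cancel_left₀]
  exact pow_ne_zero _ (by exact_mod_cast hc.ne')

lemma component_eq_torusCoeff (hR : 0 < R) (hf : DifferentiableOn ℂ f (Metric.ball 0 R))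
    (k : ℕ →₀ ℕ) {x : lp X 1} (hx : x ∈ Metric.ball 0 R) :
    component f R k x = torusCoeff f (intIndex k) x := by
  have := torusCoeff_smul_eq_component hR hf k (x := x) one_pos (by simpa using hx)
  simpa using this.symm

lemma differentiable_component (hR : 0 < R) (hf : DifferentiableOn ℂ f (Metric.ball 0 R))
    (k : ℕ →₀ ℕ) : Differentiable ℂ (component f R k) := by
  intro x₀
  have hpos : 0 < R + (‖x₀‖ + 1) := by positivity
  set c : ℝ := R / (R + (‖x₀‖ + 1)) with hc
  have hc0 : 0 < c := by positivity
  have hcx {x : lp X 1} (hx : x ∈ Metric.ball x₀ 1) : c * ‖x‖ < R := by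
    have h1 : ‖x‖ ≤ ‖x₀‖ + 1 := by
      rw [mem_ball_iff_norm] at hx
      linarith [norm_le_norm_add_norm_sub x₀ x, norm_sub_rev x₀ x]
    rw [hc, div_mul_eq_mul_div, div_lt_iff₀ hpos]
    nlinarith [norm_nonneg x]
  have hd : DifferentiableOn ℂ (fun x : lp X 1 => ((c : ℂ) ^ k.degree)⁻¹ *
      torusCoeff f (intIndex k) ((c : ℂ) • x)) (Metric.ball x₀ 1) := by
    refine ((differentiableOn_torusCoeff hf (intIndex k)).comp
      (by fun_prop) fun x hx => ?_).const_mul _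
    rw [mem_ball_zero_iff, norm_smul, Complex.norm_of_nonneg hc0.le]
    exact hcx hx
  refine (hd.differentiableAt (Metric.ball_mem_nhds x₀ one_pos)).congr_of_eventuallyEq ?_
  filter_upwards [Metric.ball_mem_nhds x₀ one_pos] with x hx
  rw [torusCoeff_smul_eq_component hR hf k hc0 (hcx hx), inv_mul_cancel_left₀]
  exact pow_ne_zero _ (by exact_mod_cast hc0.ne')

lemma component_coordScale (hR : 0 < R) (hf : DifferentiableOn ℂ f (Metric.ball 0 R))
    (k : ℕ →₀ ℕ) (x : lp X 1) {w : ℕ → ℂ} {C : ℝ} (hw : ∀ n, ‖w n‖ ≤ C) :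
    component f R k (coordScale w x) = monomialValue k w * component f R k x := by
  -- both sides are evaluated at a small multiple of `x`, with `w` divided by a bound `D`
  set D : ℝ := max C 1
  have hD : 0 < D := lt_max_of_lt_right one_pos
  have hwD (n : ℕ) : ‖w n‖ ≤ D := (hw n).trans (le_max_left _ _)
  have hD' : (D : ℂ) ≠ 0 := by exact_mod_cast hD.ne'
  set z : ℕ → ℂ := fun n => w n / D
  have hz (n : ℕ) : ‖z n‖ ≤ 1 := by
    simp only [z, norm_div, Complex.norm_of_nonneg hD.le]
    exact (div_le_one hD).2 (hwD n)
  set c : ℝ := R / (R + D * ‖x‖)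
  have hc : 0 < c := by positivity
  have hc' : (c : ℂ) ≠ 0 := by exact_mod_cast hc.ne'
  have hcx : c * (D * ‖x‖) < R := by
    have : 0 ≤ D * ‖x‖ := by positivity
    simp only [c]
    rw [div_mul_eq_mul_div, div_lt_iff₀ (by positivity)]
    nlinarith
  have hwz : w = z * fun _ => (D : ℂ) := by
    ext n
    simp only [z, Pi.mul_apply]
    field_simp
  have h1 := torusCoeff_smul_eq_component hR hf k (x := coordScale w x) hc
    (lt_of_le_of_lt (mul_le_mul_of_nonneg_left (norm_coordScale_le hwD x) hc.le) hcx)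
  have h2 := torusCoeff_smul_eq_component hR hf k (x := x) (c := c * D) (by positivity)
    (by rwa [mul_assoc])
  have h3 : (c : ℂ) • coordScale w x = coordScale z (((c * D : ℝ) : ℂ) • x) := by
    rw [hwz, coordScale_mul hz (D := D) (fun _ => (Complex.norm_of_nonneg hD.le).le),
      coordScale_const, ← coordScale_smul hz, smul_smul, Complex.ofReal_mul]
  have h4 := torusCoeff_coordScale hf k (x := ((c * D : ℝ) : ℂ) • x)
    (by rwa [mem_ball_zero_iff, norm_smul, Complex.norm_of_nonneg (by positivity), mul_assoc]) hz
  rw [← h3, h1, h2] at h4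
  refine mul_left_cancel₀ (pow_ne_zero k.degree hc') (h4.trans ?_)
  have h5 : monomialValue k w = monomialValue k z * (D : ℂ) ^ k.degree := by
    conv_lhs => rw [hwz, monomialValue_mul, monomialValue_const]
  rw [h5, Complex.ofReal_mul]
  ring

lemma hasSum_component (hR : 0 < R) (hf : DifferentiableOn ℂ f (Metric.ball 0 R))
    {x : lp X 1} (hx : x ∈ Metric.ball 0 R) (hs : Summable fun k => component f R k x) :
    HasSum (fun k => component f R k x) (f x) := by
  have hzero (k : ℕ →₀ ℤ) (hk : k ∉ Set.range intIndex) : torusCoeff f k x = 0 := by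
    have : ∃ n, k n < 0 := by
      by_contra! h
      refine hk ⟨k.mapRange Int.toNat rfl, ?_⟩
      ext n
      simp [intIndex_apply, h n]
    obtain ⟨n, hn⟩ := this
    exact torusCoeff_eq_zero_of_neg hf hx hn
  have hcomp : (fun k => component f R k x) = (fun k => torusCoeff f k x) ∘ intIndex := by
    ext k
    exact component_eq_torusCoeff hR hf k hx
  rw [hcomp] at hs ⊢
  rw [intIndex_injective.summable_iff hzero] at hs
  rw [intIndex_injective.hasSum_iff hzero]
  have := hasSum_fourier_infTorus (u := ⟨_, continuous_comp_torusAct hf hx⟩) hs fun k => rfl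
  simpa [torusAct_one] using this

end Components

/-! ### Multinomial weights -/

lemma sum_multinomial_mul_monomialValue_le {a : ℕ → ℝ} {θ : ℝ} (ha : ∀ n, 0 ≤ a n) (hθ : θ < 1)
    (h : ∀ s : Finset ℕ, ∑ n ∈ s, a n ≤ θ) (K : Finset (ℕ →₀ ℕ)) :
    ∑ k ∈ K, (k.multinomial : ℝ) * monomialValue k a ≤ (1 - θ)⁻¹ := by
  classical
  have hθ0 : 0 ≤ θ := by simpa using h ∅
  set S : Finset ℕ := K.biUnion Finsupp.support
  set D : ℕ := K.sup Finsupp.degree + 1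
  have hS {k : ℕ →₀ ℕ} (hk : k ∈ K) : k.support ⊆ S := Finset.subset_biUnion_of_mem _ hk
  have hmaps : ∀ k ∈ K, k.degree ∈ Finset.range D := fun k hk =>
    Finset.mem_range.2 (Nat.lt_succ_of_le (Finset.le_sup (f := Finsupp.degree) hk))
  rw [← Finset.sum_fiberwise_of_maps_to hmaps]
  have hd (d : ℕ) : ∑ k ∈ K with k.degree = d, (k.multinomial : ℝ) * monomialValue k a
      ≤ (∑ n ∈ S, a n) ^ d := by
    rw [Finset.sum_pow_eq_sum_piAntidiag]
    have himg : ∑ k ∈ K with k.degree = d, (k.multinomial : ℝ) * monomialValue k a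
        = ∑ p ∈ (K.filter (·.degree = d)).image (fun k : ℕ →₀ ℕ => (k : ℕ → ℕ)),
          (Nat.multinomial S p : ℝ) * ∏ n ∈ S, a n ^ p n := by
      rw [Finset.sum_image fun k _ l _ h => DFunLike.coe_injective h]
      refine Finset.sum_congr rfl fun k hk => ?_
      have hkS := hS (Finset.mem_filter.1 hk).1
      rw [Finsupp.multinomial_eq_of_support_subset hkS, monomialValue,
        Finsupp.prod_of_support_subset k hkS _ (by simp)]
    rw [himg]
    refine Finset.sum_le_sum_of_subset_of_nonneg (fun p hp => ?_) fun p _ _ =>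
      mul_nonneg (Nat.cast_nonneg _) (Finset.prod_nonneg fun n _ => pow_nonneg (ha n) _)
    obtain ⟨k, hk, rfl⟩ := Finset.mem_image.1 hp
    obtain ⟨hkK, hkd⟩ := Finset.mem_filter.1 hk
    refine Finset.mem_piAntidiag.2 ⟨?_, fun n hn => hS hkK (Finsupp.mem_support_iff.2 hn)⟩
    rw [← hkd, Finsupp.degree_apply]
    exact (Finset.sum_subset (hS hkK) fun n _ hn => Finsupp.notMem_support_iff.1 hn).symm
  calc ∑ d ∈ Finset.range D, ∑ k ∈ K with k.degree = d, (k.multinomial : ℝ) * monomialValue k a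
      ≤ ∑ d ∈ Finset.range D, θ ^ d := Finset.sum_le_sum fun d _ => (hd d).trans
        (pow_le_pow_left₀ (Finset.sum_nonneg fun n _ => ha n) (h S) d)
    _ ≤ ∑' d : ℕ, θ ^ d := (summable_geometric_of_lt_one hθ0 hθ).sum_le_tsum _
        fun d _ => pow_nonneg hθ0 d
    _ = (1 - θ)⁻¹ := tsum_geometric_of_lt_one hθ0 hθ

lemma factorial_mul_exp_le {k : ℕ} (hk : k ≠ 0) :
    (k.factorial : ℝ) * Real.exp k ≤ Real.exp 1 * k * (k : ℝ) ^ k := by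
  induction k with
  | zero => exact absurd rfl hk
  | succ k ih =>
    rcases eq_or_ne k 0 with rfl | hk0
    · simp
    have ih := ih hk0
    have hkpos : (0 : ℝ) < k := by exact_mod_cast Nat.pos_of_ne_zero hk0
    -- this is the inequality `exp 1 ≤ (1 + 1 / k) ^ (k + 1)`
    have h1 : Real.exp 1 * (k : ℝ) ^ (k + 1) ≤ ((k : ℝ) + 1) ^ (k + 1) := by
      have h2 : (k : ℝ) / (k + 1) ≤ Real.exp (-(1 / (k + 1))) := by
        have := Real.add_one_le_exp (-(1 / ((k : ℝ) + 1)))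
        refine le_trans (le_of_eq ?_) this
        field_simp
        ring
      have h3 : ((k : ℝ) / (k + 1)) ^ (k + 1) ≤ Real.exp (-1) := by
        refine (pow_le_pow_left₀ (by positivity) h2 (k + 1)).trans (le_of_eq ?_)
        rw [← Real.exp_nat_mul]
        congr 1
        push_cast
        field_simp
      rw [div_pow, div_le_iff₀ (by positivity)] at h3
      calc Real.exp 1 * (k : ℝ) ^ (k + 1) ≤ Real.exp 1 * (Real.exp (-1) * (k + 1) ^ (k + 1)) := by
            gcongr
        _ = _ := by rw [← mul_assoc, ← Real.exp_add]; simp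
    rw [Nat.factorial_succ]
    push_cast
    rw [Real.exp_add]
    calc ((k : ℝ) + 1) * k.factorial * (Real.exp k * Real.exp 1)
        = (k + 1) * Real.exp 1 * (k.factorial * Real.exp k) := by ring
      _ ≤ (k + 1) * Real.exp 1 * (Real.exp 1 * k * (k : ℝ) ^ k) := by gcongr
      _ = Real.exp 1 * (k + 1) * (Real.exp 1 * (k : ℝ) ^ (k + 1)) := by ring
      _ ≤ Real.exp 1 * (k + 1) * ((k : ℝ) + 1) ^ (k + 1) := by gcongr

/-- The Cauchy weight `d ^ d / ∏ k n ^ k n` exceeds the multinomial coefficient by at most a factor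
`exp 1 * k n` for each variable that occurs. -/
lemma degree_pow_le_multinomial_mul (k : ℕ →₀ ℕ) :
    (k.degree : ℝ) ^ k.degree ≤
      k.multinomial * ∏ n ∈ k.support, (Real.exp 1 * k n * (k n : ℝ) ^ k n) := by
  have hdeg : k.degree = ∑ n ∈ k.support, k n := Finsupp.degree_apply k
  have h1 : (k.degree : ℝ) ^ k.degree ≤ Real.exp k.degree * k.degree.factorial := by
    have := Real.pow_div_factorial_le_exp (k.degree : ℝ) (Nat.cast_nonneg _) k.degree
    rwa [div_le_iff₀ (by positivity)] at this
  have h2 : (k.degree.factorial : ℝ) = (∏ n ∈ k.support, ((k n).factorial : ℝ)) * k.multinomial := by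
    rw [hdeg, ← Nat.multinomial_spec, Finsupp.multinomial_eq]
    push_cast
    rfl
  have h3 : Real.exp k.degree = ∏ n ∈ k.support, Real.exp (k n) := by
    rw [hdeg, ← Real.exp_sum]
    push_cast
    rfl
  calc (k.degree : ℝ) ^ k.degree ≤ Real.exp k.degree * k.degree.factorial := h1
    _ = k.multinomial * ∏ n ∈ k.support, ((k n).factorial * Real.exp (k n)) := by
      rw [h2, h3, Finset.prod_mul_distrib]; ring
    _ ≤ _ := by
      refine mul_le_mul_of_nonneg_left (Finset.prod_le_prod (fun n _ => by positivity)
        fun n hn => factorial_mul_exp_le (Finsupp.mem_support_iff.1 hn)) (Nat.cast_nonneg _)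

lemma exists_exp_one_mul_mul_pow_le {κ : ℝ} (h0 : 0 ≤ κ) (h1 : κ < 1) :
    ∃ A : ℝ, 1 ≤ A ∧ ∀ k : ℕ, Real.exp 1 * k * κ ^ k ≤ A := by
  obtain ⟨B, hB⟩ := (tendsto_self_mul_const_pow_of_lt_one h0 h1).bddAbove_range
  refine ⟨max 1 (Real.exp 1 * B), le_max_left _ _, fun k => le_trans ?_ (le_max_right _ _)⟩
  rw [mul_assoc]
  exact mul_le_mul_of_nonneg_left (hB ⟨k, rfl⟩) (Real.exp_pos 1).le

lemma exp_one_mul_le_pow {k : ℕ} : Real.exp 1 * k ≤ Real.exp 1 ^ k := by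
  have h := Real.add_one_le_exp ((k : ℝ) - 1)
  rw [← Real.exp_nat_mul, mul_one]
  calc Real.exp 1 * k ≤ Real.exp 1 * Real.exp ((k : ℝ) - 1) := by gcongr; linarith
    _ = Real.exp k := by rw [← Real.exp_add]; congr 1; ring

/-! ### Weights tending to infinity -/

lemma exists_tendsto_atTop_tsum_mul_lt {a : ℕ → ℝ} (ha0 : ∀ n, 0 ≤ a n) (ha : Summable a) {s : ℝ}
    (hs : ∑' n, a n < s) : ∃ b : ℕ → ℝ, (∀ n, 1 ≤ b n) ∧ Tendsto b atTop atTop ∧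
      ∃ s' < s, ∀ S : Finset ℕ, ∑ n ∈ S, a n * b n ≤ s' := by
  -- `b = 1 + η / √t` with `t n` the tail sum of the perturbed sequence `a' > 0`
  set a' : ℕ → ℝ := fun n => a n + (1 / 2) ^ n
  have ha'0 (n : ℕ) : 0 < a' n := add_pos_of_nonneg_of_pos (ha0 n) (by positivity)
  have ha' : Summable a' := ha.add summable_geometric_two
  set t : ℕ → ℝ := fun n => ∑' i, a' (i + n)
  have htsum (n : ℕ) : Summable fun i => a' (i + n) := (summable_nat_add_iff n).2 ha'
  have ht0 (n : ℕ) : 0 < t n := (htsum n).tsum_pos (fun i => (ha'0 _).le) 0 (ha'0 _)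
  have hstep (n : ℕ) : t n = a' n + t (n + 1) := by
    have := (htsum n).tsum_eq_zero_add
    simp only [t]
    rw [this, zero_add]
    congr 2
    ext i
    congr 1
    ring
  have htlim : Tendsto t atTop (𝓝 0) := tendsto_sum_nat_add a'
  have hterm (n : ℕ) : a n / √(t n) ≤ 2 * √(t n) - 2 * √(t (n + 1)) := by
    have hp := Real.sqrt_pos.2 (ht0 n)
    rw [div_le_iff₀ hp]
    have h1 := Real.sq_sqrt (ht0 n).le
    have h2 := Real.sq_sqrt (ht0 (n + 1)).le
    have h3 : a n ≤ a' n := le_add_of_nonneg_right (by positivity)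
    have h4 := hstep n
    nlinarith [sq_nonneg (√(t n) - √(t (n + 1)))]
  have hpart (S : Finset ℕ) : ∑ n ∈ S, a n / √(t n) ≤ 2 * √(t 0) := by
    obtain ⟨N, hN⟩ := S.exists_nat_subset_range
    calc ∑ n ∈ S, a n / √(t n) ≤ ∑ n ∈ Finset.range N, a n / √(t n) :=
          Finset.sum_le_sum_of_subset_of_nonneg hN fun n _ _ =>
            div_nonneg (ha0 n) (Real.sqrt_nonneg _)
      _ ≤ ∑ n ∈ Finset.range N, (2 * √(t n) - 2 * √(t (n + 1))) :=
          Finset.sum_le_sum fun n _ => hterm n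
      _ = 2 * √(t 0) - 2 * √(t N) := Finset.sum_range_sub' (fun n => 2 * √(t n)) N
      _ ≤ 2 * √(t 0) := by linarith [Real.sqrt_nonneg (t N)]
  set T : ℝ := 2 * √(t 0)
  have hT : 0 < T := by have := Real.sqrt_pos.2 (ht0 0); positivity
  set η : ℝ := (s - ∑' n, a n) / (2 * T)
  have hη : 0 < η := div_pos (sub_pos.2 hs) (by positivity)
  refine ⟨fun n => 1 + η / √(t n), fun n => ?_, ?_, ∑' n, a n + η * T, ?_, fun S => ?_⟩
  · exact le_add_of_nonneg_right (by positivity)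
  · refine tendsto_atTop_add_const_left _ _ (Tendsto.const_mul_atTop hη ?_)
    refine Tendsto.inv_tendsto_nhdsGT_zero (tendsto_nhdsWithin_iff.2 ⟨?_, ?_⟩)
    · simpa [Function.comp_def] using (Real.continuous_sqrt.tendsto 0).comp htlim
    · exact Eventually.of_forall fun n => Real.sqrt_pos.2 (ht0 n)
  · have : η * T = (s - ∑' n, a n) / 2 := by simp only [η]; field_simp
    linarith
  · have h1 : ∑ n ∈ S, a n * (1 + η / √(t n)) = ∑ n ∈ S, a n + η * ∑ n ∈ S, a n / √(t n) := by
      rw [Finset.mul_sum, ← Finset.sum_add_distrib]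
      exact Finset.sum_congr rfl fun n _ => by ring
    rw [h1]
    exact add_le_add (ha.sum_le_tsum S fun n _ => ha0 n)
      (mul_le_mul_of_nonneg_left (hpart S) hη.le)

lemma exists_tendsto_zero_sum_div_pow_le {a : ℕ → ℝ} (ha0 : ∀ n, 0 ≤ a n) (ha : Summable a)
    {ρ : ℝ} (hρ : 0 < ρ) {p : ℕ} (hp : p ≠ 0) (hs : ∑' n, a n < ρ ^ p) :
    ∃ σ : ℕ → ℝ, (∀ n, 0 < σ n) ∧ (∀ n, σ n ≤ ρ) ∧ Tendsto σ atTop (𝓝 0) ∧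
      ∃ θ < 1, ∀ S : Finset ℕ, ∑ n ∈ S, a n / σ n ^ p ≤ θ := by
  obtain ⟨b, hb1, hb, s', hs', hsum⟩ := exists_tendsto_atTop_tsum_mul_lt ha0 ha hs
  have hb0 (n : ℕ) : 0 < b n := one_pos.trans_le (hb1 n)
  have hp' : (0 : ℝ) < (p : ℝ)⁻¹ := inv_pos.2 (by exact_mod_cast Nat.pos_of_ne_zero hp)
  have hpow (n : ℕ) : (ρ * b n ^ (-(p : ℝ)⁻¹)) ^ p = ρ ^ p / b n := by
    rw [mul_pow, Real.rpow_neg (hb0 n).le, inv_pow, Real.rpow_inv_natCast_pow (hb0 n).le hp]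
    rfl
  refine ⟨fun n => ρ * b n ^ (-(p : ℝ)⁻¹), fun n => ?_, fun n => ?_, ?_, s' / ρ ^ p, ?_,
    fun S => ?_⟩
  · have := Real.rpow_pos_of_pos (hb0 n) (-(p : ℝ)⁻¹)
    positivity
  · exact mul_le_of_le_one_right hρ.le
      (Real.rpow_le_one_of_one_le_of_nonpos (hb1 n) (neg_nonpos.2 hp'.le))
  · simpa using ((tendsto_rpow_neg_atTop hp').comp hb).const_mul ρ
  · exact (div_lt_one (by positivity)).2 hs'
  · rw [le_div_iff₀ (by positivity), Finset.sum_mul]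
    refine le_trans (le_of_eq (Finset.sum_congr rfl fun n _ => ?_)) (hsum S)
    have := (hb0 n).ne'
    rw [hpow]
    field_simp

/-! ### Weighted Cauchy estimates -/

section Estimates

variable {X : ℕ → Type*} [∀ n, NormedAddCommGroup (X n)]

/-- Multinomial bounds on a family `F k` make its sum converge wherever `∑ ‖x n‖ / ν n < 1`. -/
lemma sum_norm_le_of_multinomial_bound {ι : Type*} {e : ι → ℕ →₀ ℕ} (he : Function.Injective e)
    {F : ι → lp X 1 → ℂ} {C θ : ℝ} {ν : ℕ → ℝ} (hC : 0 ≤ C) (hν : ∀ n, 0 < ν n) {x : lp X 1}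
    (hF : ∀ i, ‖F i x‖ ≤ C * ((e i).multinomial * monomialValue (e i) fun n => ‖x n‖ / ν n))
    (hθ : θ < 1) (hx : ∀ S : Finset ℕ, ∑ n ∈ S, ‖x n‖ / ν n ≤ θ) (s : Finset ι) :
    ∑ i ∈ s, ‖F i x‖ ≤ C * (1 - θ)⁻¹ := by
  classical
  calc ∑ i ∈ s, ‖F i x‖
      ≤ ∑ i ∈ s, C * ((e i).multinomial * monomialValue (e i) fun n => ‖x n‖ / ν n) :=
        Finset.sum_le_sum fun i _ => hF i
    _ = C * ∑ k ∈ s.map ⟨e, he⟩, (k.multinomial * monomialValue k fun n => ‖x n‖ / ν n) := by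
        rw [Finset.mul_sum, Finset.sum_map]; rfl
    _ ≤ C * (1 - θ)⁻¹ := mul_le_mul_of_nonneg_left (sum_multinomial_mul_monomialValue_le
        (fun n => div_nonneg (norm_nonneg _) (hν n).le) hθ hx _) hC

variable [∀ n, NormedSpace ℂ (X n)] {f : lp X 1 → ℂ} {R : ℝ}

lemma exists_norm_le_of_sum_norm_div_le [∀ n, FiniteDimensional ℂ (X n)]
    (hf : DifferentiableOn ℂ f (Metric.ball 0 R)) {σ : ℕ → ℝ} {ρ : ℝ} (hρR : ρ < R)
    (hσ : ∀ n, 0 < σ n) (hσρ : ∀ n, σ n ≤ ρ) (hσ0 : Tendsto σ atTop (𝓝 0)) :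
    ∃ δ > 0, ∃ M, ∀ (N : ℕ) (y : lp X 1),
      (∀ s : Finset ℕ, ∑ n ∈ s, ‖y n‖ / (if n < N then σ n else δ) ≤ 1) →
      y ∈ Metric.ball 0 R ∧ ‖f y‖ ≤ M := by
  classical
  have hsub : {y : lp X 1 | ∀ s : Finset ℕ, ∑ n ∈ s, ‖y n‖ / σ n ≤ 1} ⊆ Metric.ball 0 R := by
    intro y hy
    rw [mem_ball_zero_iff]
    refine lt_of_le_of_lt (norm_lp_one_le_of_sum_le fun s => ?_) hρR
    have hρ : 0 ≤ ρ := (hσ 0).le.trans (hσρ 0)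
    calc ∑ n ∈ s, ‖y n‖ = ∑ n ∈ s, σ n * (‖y n‖ / σ n) :=
          Finset.sum_congr rfl fun n _ => (mul_div_cancel₀ _ (hσ n).ne').symm
      _ ≤ ∑ n ∈ s, ρ * (‖y n‖ / σ n) := Finset.sum_le_sum fun n _ =>
          mul_le_mul_of_nonneg_right (hσρ n) (div_nonneg (norm_nonneg _) (hσ n).le)
      _ ≤ ρ := by
          rw [← Finset.mul_sum]
          exact mul_le_of_le_one_right hρ (hy s)
  obtain ⟨δ, hδ, M, hM⟩ :=
    (isCompact_setOf_sum_norm_div_le (X := X) hσ hσ0).exists_norm_le_of_dist_lt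
      Metric.isOpen_ball hsub hf.continuousOn
  refine ⟨δ / 2, half_pos hδ, M, fun N y hy => ?_⟩
  -- split `y` into its first `N` components and a remainder of norm at most `δ / 2`
  set z : ℕ → ℂ := fun n => if n < N then 1 else 0
  have hz (n : ℕ) : ‖z n‖ ≤ 1 := by
    by_cases h : n < N <;> simp [z, h]
  refine hM (coordScale z y) (fun s => ?_) y ?_
  · refine le_trans (le_trans (le_of_eq ?_) (Finset.sum_le_sum_of_subset_of_nonneg
      (s.filter_subset (· < N)) fun n _ _ => ?_)) (hy s)
    · rw [Finset.sum_filter]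
      refine Finset.sum_congr rfl fun n _ => ?_
      rw [coordScale_apply hz]
      by_cases h : n < N <;> simp [z, h]
    · by_cases h : n < N <;> simp only [h, if_true, if_false]
      · exact div_nonneg (norm_nonneg _) (hσ n).le
      · positivity
  · rw [dist_eq_norm]
    refine lt_of_le_of_lt (norm_lp_one_le_of_sum_le (C := δ / 2) fun s => ?_) (half_lt_self hδ)
    have h1 := hy (s.filter (¬ · < N))
    have h2 : ∑ n ∈ s, ‖(y - coordScale z y) n‖
        = δ / 2 * ∑ n ∈ s with ¬ n < N, ‖y n‖ / (if n < N then σ n else δ / 2) := by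
      rw [Finset.mul_sum, Finset.sum_filter]
      refine Finset.sum_congr rfl fun n _ => ?_
      rw [lp.coeFn_sub, Pi.sub_apply, coordScale_apply hz]
      by_cases h : n < N
      · simp [z, h]
      · simp only [z, h, if_false, zero_smul, sub_zero, not_false_eq_true, if_true]
        field_simp
    rw [h2]
    exact mul_le_of_le_one_right (half_pos hδ).le h1

/-- Cauchy's estimate on the weighted ball `∑ ‖y n‖ / s n ≤ 1`, in the form that avoids division
by the norms of the components of `x`. The test vector has `‖y n‖ = s n * k n / k.degree`, which
maximizes `∏ ‖y n‖ ^ k n`. -/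
lemma norm_component_mul_prod_le (hR : 0 < R) (hf : DifferentiableOn ℂ f (Metric.ball 0 R))
    {s : ℕ → ℝ} (hs : ∀ n, 0 < s n) {M : ℝ}
    (hM : ∀ y : lp X 1, (∀ S : Finset ℕ, ∑ n ∈ S, ‖y n‖ / s n ≤ 1) →
      y ∈ Metric.ball 0 R ∧ ‖f y‖ ≤ M) (k : ℕ →₀ ℕ) (x : lp X 1) :
    ‖component f R k x‖ * ∏ n ∈ k.support, (s n * k n) ^ k n
      ≤ M * (k.degree : ℝ) ^ k.degree * ∏ n ∈ k.support, ‖x n‖ ^ k n := by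
  classical
  have hM0 : 0 ≤ M := (norm_nonneg _).trans (hM 0 (by simp)).2
  by_cases hx : ∃ n ∈ k.support, x n = 0
  · -- then `x` does not change when its `n`-th component is multiplied by `0`
    obtain ⟨n, hn, hxn⟩ := hx
    have h1 := component_coordScale hR hf k x
      (norm_update_one_le (n := n) (ζ := 0) le_rfl (by simp))
    have h2 : monomialValue k (Function.update (1 : ℕ → ℂ) n 0) = 0 :=
      Finset.prod_eq_zero hn (by simpa using Finsupp.mem_support_iff.1 hn)
    rw [coordScale_update_one, hxn, lp.single_zero, smul_zero, add_zero, h2, zero_mul] at h1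
    rw [h1, norm_zero, zero_mul]
    positivity
  push Not at hx
  set d : ℕ := k.degree
  have hdeg : d = ∑ n ∈ k.support, k n := Finsupp.degree_apply k
  have hxn {n : ℕ} (hn : n ∈ k.support) : 0 < ‖x n‖ := norm_pos_iff.2 (hx n hn)
  set w : ℕ → ℝ := fun n => s n * k n / d / ‖x n‖
  have hw0 (n : ℕ) : 0 ≤ w n := by have := (hs n).le; positivity
  have hwn (n : ℕ) (hn : n ∉ k.support) : w n = 0 := by
    simp [w, Finsupp.notMem_support_iff.1 hn]
  have hwC (n : ℕ) : ‖(w n : ℂ)‖ ≤ ∑ m ∈ k.support, w m := by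
    rw [Complex.norm_of_nonneg (hw0 n)]
    by_cases hn : n ∈ k.support
    · exact Finset.single_le_sum (fun m _ => hw0 m) hn
    · rw [hwn n hn]; exact Finset.sum_nonneg fun m _ => hw0 m
  set y : lp X 1 := coordScale (fun n => (w n : ℂ)) x
  have hy (n : ℕ) : ‖y n‖ / s n ≤ k n / d := by
    rw [coordScale_apply hwC, norm_smul, Complex.norm_of_nonneg (hw0 n)]
    by_cases hn : n ∈ k.support
    · have h1 := (hxn hn).ne'
      have h2 := (hs n).ne'
      refine le_of_eq ?_
      simp only [w]
      field_simp
    · rw [hwn n hn, zero_mul, zero_div]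
      positivity
  have hysum (S : Finset ℕ) : ∑ n ∈ S, ‖y n‖ / s n ≤ 1 := by
    have h1 : ∑ n ∈ S, k n ≤ d := by
      rw [hdeg, ← Finset.sum_filter_ne_zero S]
      exact Finset.sum_le_sum_of_subset fun n hn =>
        Finsupp.mem_support_iff.2 (Finset.mem_filter.1 hn).2
    calc ∑ n ∈ S, ‖y n‖ / s n ≤ ∑ n ∈ S, (k n : ℝ) / d := Finset.sum_le_sum fun n _ => hy n
      _ = ((∑ n ∈ S, k n : ℕ) : ℝ) / d := by rw [← Finset.sum_div]; push_cast; rfl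
      _ ≤ 1 := div_le_one_of_le₀ (by exact_mod_cast h1) (Nat.cast_nonneg _)
  have hyR := (hM y hysum).1
  have hyM : ‖component f R k y‖ ≤ M := by
    rw [component_eq_torusCoeff hR hf k hyR]
    refine norm_torusCoeff_le (fun ω => (hM _ fun S => ?_).2) _
    refine le_trans (Finset.sum_le_sum fun n _ => ?_) (hysum S)
    rw [torusAct, coordScale_apply (norm_torus_apply_le ω), norm_smul, Circle.norm_coe, one_mul]
  rw [component_coordScale hR hf k x hwC, norm_mul, monomialValue, Finsupp.prod, norm_prod] at hyM
  have hprod : (∏ n ∈ k.support, ‖(w n : ℂ) ^ k n‖) * ((d : ℝ) ^ d * ∏ n ∈ k.support, ‖x n‖ ^ k n)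
      = ∏ n ∈ k.support, (s n * k n) ^ k n := by
    have h1 : (d : ℝ) ^ d = ∏ n ∈ k.support, (d : ℝ) ^ k n := by
      rw [Finset.prod_pow_eq_pow_sum, ← hdeg]
    rw [h1, ← Finset.prod_mul_distrib, ← Finset.prod_mul_distrib]
    refine Finset.prod_congr rfl fun n hn => ?_
    have hd0 : (d : ℝ) ≠ 0 := by
      have : k n ≤ d := hdeg ▸ Finset.single_le_sum (fun m _ => Nat.zero_le (k m)) hn
      have h2 := Finsupp.mem_support_iff.1 hn
      exact_mod_cast (by omega : d ≠ 0)
    have h3 := (hxn hn).ne'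
    rw [norm_pow, Complex.norm_of_nonneg (hw0 n), ← mul_pow, ← mul_pow]
    congr 1
    simp only [w]
    field_simp
  rw [← hprod]
  calc _ = ((∏ n ∈ k.support, ‖(w n : ℂ) ^ k n‖) * ‖component f R k x‖)
        * ((d : ℝ) ^ d * ∏ n ∈ k.support, ‖x n‖ ^ k n) := by ring
    _ ≤ M * ((d : ℝ) ^ d * ∏ n ∈ k.support, ‖x n‖ ^ k n) :=
        mul_le_mul_of_nonneg_right hyM (by positivity)
    _ = _ := by ring

/-- Cauchy estimates with multinomial weights, derived from the boundedness of `f` near the compact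
set `∑ ‖y n‖ / σ n ≤ 1`. The loss `exp 1 * k n` per variable against the sharp weights is absorbed
in the factor `κ < 1` for finitely many variables, and in a smaller lower bound of the weights `τ`
for the others. -/
lemma exists_norm_component_le [∀ n, FiniteDimensional ℂ (X n)] (hR : 0 < R)
    (hf : DifferentiableOn ℂ f (Metric.ball 0 R)) {σ : ℕ → ℝ} {ρ κ : ℝ} (hρR : ρ < R)
    (hσ : ∀ n, 0 < σ n) (hσρ : ∀ n, σ n ≤ ρ) (hσ0 : Tendsto σ atTop (𝓝 0))
    (hκ0 : 0 < κ) (hκ1 : κ < 1) :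
    ∃ τ : ℕ → ℝ, (∃ c > 0, ∀ n, c ≤ τ n) ∧ (∀ n, κ * σ n ≤ τ n) ∧ ∃ C > 0,
      ∀ (k : ℕ →₀ ℕ) (x : lp X 1), ‖component f R k x‖
        ≤ C * (k.multinomial * monomialValue k fun n => ‖x n‖ / τ n) := by
  obtain ⟨δ, hδ, M, hM⟩ := exists_norm_le_of_sum_norm_div_le hf hρR hσ hσρ hσ0
  have hM0 : 0 ≤ M := (norm_nonneg _).trans (hM 0 0 (by simp)).2
  obtain ⟨A, hA1, hA⟩ := exists_exp_one_mul_mul_pow_le hκ0.le hκ1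
  have he : 0 < Real.exp 1 := Real.exp_pos 1
  obtain ⟨N, hN⟩ := eventually_atTop.1
    (hσ0.eventually (Iio_mem_nhds (div_pos hδ he)))
  set s : ℕ → ℝ := fun n => if n < N then σ n else δ
  have hs (n : ℕ) : 0 < s n := by
    by_cases h : n < N
    · simpa [s, h] using hσ n
    · simpa [s, h] using hδ
  set τ : ℕ → ℝ := fun n => if n < N then κ * σ n else δ / Real.exp 1
  have hτ (n : ℕ) : 0 < τ n := by
    by_cases h : n < N
    · simpa [τ, h] using mul_pos hκ0 (hσ n)
    · simpa [τ, h] using div_pos hδ he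
  refine ⟨τ, ?_, fun n => ?_, (M + 1) * A ^ N, by positivity, fun k x => ?_⟩
  · set B : Finset ℝ := insert (δ / Real.exp 1) ((Finset.range N).image τ)
    have hne : B.Nonempty := Finset.insert_nonempty _ _
    refine ⟨B.min' hne, (Finset.lt_min'_iff _ hne).2 fun a ha => ?_,
      fun n => Finset.min'_le B _ ?_⟩
    · rcases Finset.mem_insert.1 ha with rfl | ha
      · exact div_pos hδ he
      · obtain ⟨n, -, rfl⟩ := Finset.mem_image.1 ha
        exact hτ n
    · by_cases h : n < N
      · exact Finset.mem_insert_of_mem (Finset.mem_image_of_mem _ (Finset.mem_range.2 h))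
      · simp [B, τ, h]
  · by_cases h : n < N
    · simp [τ, h]
    · have h1 : σ n < δ / Real.exp 1 := hN n (not_lt.1 h)
      simp only [τ, h, if_false]
      nlinarith [hσ n]
  · have hcauchy := norm_component_mul_prod_le hR hf hs (hM N) k x
    have hpos : 0 < ∏ n ∈ k.support, (s n * k n) ^ k n := Finset.prod_pos fun n hn => by
      have : (0 : ℝ) < k n := by
        exact_mod_cast Nat.pos_of_ne_zero (Finsupp.mem_support_iff.1 hn)
      have := hs n
      positivity
    have hterm (n : ℕ) : Real.exp 1 * k n * ‖x n‖ ^ k n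
        ≤ (if n < N then A else 1) * (‖x n‖ / τ n) ^ k n * s n ^ k n := by
      by_cases h : n < N
      · have h1 := (hσ n).ne'
        have h2 := hA (k n)
        have h3 : (‖x n‖ / (κ * σ n)) ^ k n * σ n ^ k n = ‖x n‖ ^ k n / κ ^ k n := by
          rw [← mul_pow, ← div_pow]
          congr 1
          field_simp
        simp only [τ, s, h, if_true]
        rw [mul_assoc A, h3, ← mul_div_assoc, le_div_iff₀ (by positivity)]
        calc _ = Real.exp 1 * k n * κ ^ k n * ‖x n‖ ^ k n := by ring
          _ ≤ A * ‖x n‖ ^ k n := by gcongr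
      · have h3 : (‖x n‖ / (δ / Real.exp 1)) ^ k n * δ ^ k n = Real.exp 1 ^ k n * ‖x n‖ ^ k n := by
          rw [← mul_pow, ← mul_pow]
          congr 1
          field_simp
        simp only [τ, s, h, if_false]
        rw [one_mul, h3]
        gcongr
        exact exp_one_mul_le_pow
    have hAN : ∏ n ∈ k.support, (if n < N then A else 1) ≤ A ^ N := by
      rw [← Finset.prod_filter, Finset.prod_const]
      refine pow_le_pow_right₀ hA1 ?_
      have : k.support.filter (· < N) ⊆ Finset.range N := fun n hn =>
        Finset.mem_range.2 (Finset.mem_filter.1 hn).2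
      simpa using Finset.card_le_card this
    have hmono : 0 ≤ monomialValue k fun n => ‖x n‖ / τ n :=
      Finset.prod_nonneg fun n _ => pow_nonneg (div_nonneg (norm_nonneg _) (hτ n).le) _
    refine le_of_mul_le_mul_right ?_ hpos
    calc ‖component f R k x‖ * ∏ n ∈ k.support, (s n * k n) ^ k n
        ≤ M * (k.degree : ℝ) ^ k.degree * ∏ n ∈ k.support, ‖x n‖ ^ k n := hcauchy
      _ ≤ M * (k.multinomial * ∏ n ∈ k.support, (Real.exp 1 * k n * (k n : ℝ) ^ k n))
          * ∏ n ∈ k.support, ‖x n‖ ^ k n := by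
          gcongr
          exact degree_pow_le_multinomial_mul k
      _ = M * k.multinomial * ∏ n ∈ k.support,
          (Real.exp 1 * k n * ‖x n‖ ^ k n * (k n : ℝ) ^ k n) := by
          simp only [Finset.prod_mul_distrib]
          ring
      _ ≤ M * k.multinomial * ∏ n ∈ k.support, ((if n < N then A else 1)
          * (‖x n‖ / τ n) ^ k n * s n ^ k n * (k n : ℝ) ^ k n) := by
          refine mul_le_mul_of_nonneg_left (Finset.prod_le_prod (fun n _ => by positivity)
            fun n _ => mul_le_mul_of_nonneg_right (hterm n) (by positivity)) (by positivity)
      _ = M * k.multinomial * ((∏ n ∈ k.support, (if n < N then A else 1))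
          * (monomialValue k fun n => ‖x n‖ / τ n) * ∏ n ∈ k.support, (s n * k n) ^ k n) := by
          simp only [mul_pow, Finset.prod_mul_distrib, monomialValue, Finsupp.prod]
          ring
      _ ≤ (M + 1) * k.multinomial * (A ^ N
          * (monomialValue k fun n => ‖x n‖ / τ n) * ∏ n ∈ k.support, (s n * k n) ^ k n) := by
          gcongr
          linarith
      _ = _ := by ring

lemma differentiableAt_tsum_of_multinomial_bound {ι : Type*} {e : ι → ℕ →₀ ℕ}
    (he : Function.Injective e) {F : ι → lp X 1 → ℂ} (hd : ∀ i, Differentiable ℂ (F i))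
    {C θ c : ℝ} {ν : ℕ → ℝ} (hC : 0 ≤ C) (hc : 0 < c) (hν : ∀ n, c ≤ ν n)
    (hF : ∀ i x, ‖F i x‖ ≤ C * ((e i).multinomial * monomialValue (e i) fun n => ‖x n‖ / ν n))
    (hθ : θ < 1) {x₀ : lp X 1} (hx₀ : ∀ S : Finset ℕ, ∑ n ∈ S, ‖x₀ n‖ / ν n ≤ θ) :
    DifferentiableAt ℂ (fun x => ∑' i, F i x) x₀ := by
  have hν0 (n : ℕ) : 0 < ν n := hc.trans_le (hν n)
  refine differentiableAt_tsum_of_sum_norm_le (δ := c * ((1 - θ) / 2))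
    (B := C * (1 - (1 + θ) / 2)⁻¹) (mul_pos hc (by linarith)) hd fun x hx s =>
      sum_norm_le_of_multinomial_bound he hC hν0 (fun i => hF i x) (by linarith) (fun S => ?_) s
  have h1 : ∑ n ∈ S, ‖(x - x₀) n‖ / ν n ≤ (1 - θ) / 2 := by
    calc ∑ n ∈ S, ‖(x - x₀) n‖ / ν n ≤ ∑ n ∈ S, ‖(x - x₀) n‖ / c :=
          Finset.sum_le_sum fun n _ => div_le_div_of_nonneg_left (norm_nonneg _) hc (hν n)
      _ = (∑ n ∈ S, ‖(x - x₀) n‖) / c := by rw [Finset.sum_div]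
      _ ≤ ‖x - x₀‖ / c := by
          gcongr
          exact sum_le_hasSum S (fun _ _ => norm_nonneg _) (hasSum_norm_lp_one (x - x₀))
      _ ≤ (1 - θ) / 2 := by
          rw [div_le_iff₀ hc, mul_comm]
          exact (mem_ball_iff_norm.1 hx).le
  calc ∑ n ∈ S, ‖x n‖ / ν n ≤ ∑ n ∈ S, (‖x₀ n‖ / ν n + ‖(x - x₀) n‖ / ν n) := by
        refine Finset.sum_le_sum fun n _ => ?_
        rw [← add_div]
        have : ‖x n‖ ≤ ‖x₀ n‖ + ‖(x - x₀) n‖ := by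
          rw [lp.coeFn_sub, Pi.sub_apply]
          exact norm_le_norm_add_norm_sub' _ _
        exact div_le_div_of_nonneg_right this (hν0 n).le
    _ ≤ θ + (1 - θ) / 2 := by
        rw [Finset.sum_add_distrib]
        exact add_le_add (hx₀ S) h1
    _ = (1 + θ) / 2 := by ring

end Estimates

/-! ### The splitting of the expansion -/

section Splitting

variable {X : ℕ → Type*} [∀ n, NormedAddCommGroup (X n)]

lemma monomialValue_norm_div_nonneg {τ : ℕ → ℝ} (hτ : ∀ n, 0 < τ n) (k : ℕ →₀ ℕ) (x : lp X 1) :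
    0 ≤ monomialValue k fun n => ‖x n‖ / τ n :=
  Finset.prod_nonneg fun n _ => pow_nonneg (div_nonneg (norm_nonneg _) (hτ n).le) _

variable [∀ n, NormedSpace ℂ (X n)]

lemma summable_component [∀ n, FiniteDimensional ℂ (X n)] {f : lp X 1 → ℂ} {R : ℝ} (hR : 0 < R)
    (hf : DifferentiableOn ℂ f (Metric.ball 0 R)) {x : lp X 1} (hx : x ∈ Metric.ball 0 R) :
    Summable fun k => component f R k x := by
  rw [mem_ball_zero_iff] at hx
  set ρ : ℝ := (‖x‖ + R) / 2
  have hx0 := norm_nonneg x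
  have hρ : 0 < ρ := by positivity
  have hxρ : ‖x‖ < ρ := by simp only [ρ]; linarith
  have hρR : ρ < R := by simp only [ρ]; linarith
  obtain ⟨κ, hκ1, hκ2⟩ := exists_between ((div_lt_one hρ).2 hxρ)
  have hκ0 : 0 < κ := (div_nonneg hx0 hρ.le).trans_lt hκ1
  have hsx := hasSum_norm_lp_one x
  obtain ⟨σ, hσ, hσρ, hσ0, θ, hθ, hsum⟩ := exists_tendsto_zero_sum_div_pow_le
    (a := fun n => ‖x n‖ / κ) (fun n => by positivity) (hsx.summable.div_const κ) hρ one_ne_zero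
    (by rw [tsum_div_const, hsx.tsum_eq, pow_one]; exact (div_lt_comm₀ hρ hκ0).1 hκ1)
  obtain ⟨τ, ⟨c, hc, hcτ⟩, hτσ, C, hC, hbound⟩ :=
    exists_norm_component_le hR hf hρR hσ hσρ hσ0 hκ0 hκ2
  refine Summable.of_norm (summable_of_sum_le (fun _ => norm_nonneg _)
    (sum_norm_le_of_multinomial_bound (e := id) (F := component f R) Function.injective_id hC.le
      (fun n => hc.trans_le (hcτ n)) (fun k => hbound k x) hθ fun S => ?_))
  refine le_trans (Finset.sum_le_sum fun n _ => ?_) (hsum S)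
  rw [pow_one, div_div]
  exact div_le_div_of_nonneg_left (norm_nonneg _) (mul_pos hκ0 (hσ n)) (hτσ n)

/-- The multi-indices `k` for which `‖component f R k x‖` exceeds `ε` times the `k`-th term of the
multinomial series `∑ m_k * ∏ n, (‖x n‖ / r) ^ k n` for some `x`. On a ball of radius less than `r`
the components of the other indices sum to at most a constant multiple of `ε`. -/
def largeIndices (f : lp X 1 → ℂ) (R r ε : ℝ) : Set (ℕ →₀ ℕ) :=
  {k | ∃ x, ε * (k.multinomial * monomialValue k fun n => ‖x n‖ / r) < ‖component f R k x‖}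

/-- Every Cauchy estimate with weights `τ` improves on the large indices: combined with the lower
bound that defines them it gives `1 ≤ (C / ε) * ∏ n, (r / τ n) ^ k n`, and multiplying the estimate
by the `j`-th power of this inequality replaces `τ n` by `τ n ^ (j + 1) / r ^ j`. -/
lemma norm_component_le_of_mem_largeIndices {f : lp X 1 → ℂ} {R r ε C : ℝ} {τ : ℕ → ℝ}
    (hr : 0 < r) (hε : 0 < ε) (hC : 0 < C) (hτ : ∀ n, 0 < τ n) {k : ℕ →₀ ℕ}
    (hbound : ∀ x, ‖component f R k x‖
      ≤ C * (k.multinomial * monomialValue k fun n => ‖x n‖ / τ n))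
    (hk : k ∈ largeIndices f R r ε) (j : ℕ) (x : lp X 1) :
    ‖component f R k x‖ ≤ C * (C / ε) ^ j *
      (k.multinomial * monomialValue k fun n => ‖x n‖ / (τ n ^ (j + 1) / r ^ j)) := by
  have hlarge : 1 ≤ C / ε * monomialValue k fun n => r / τ n := by
    obtain ⟨x, hx⟩ := hk
    have h1 := hx.trans_le (hbound x)
    have h2 : (fun n => ‖x n‖ / τ n) = (fun n => ‖x n‖ / r) * fun n => r / τ n := by
      ext n
      simp only [Pi.mul_apply]
      field_simp
    rw [h2, monomialValue_mul] at h1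
    set m := (k.multinomial : ℝ) * monomialValue k fun n => ‖x n‖ / r with hm
    have hm0 : 0 ≤ m :=
      mul_nonneg (Nat.cast_nonneg _) (monomialValue_norm_div_nonneg (fun _ => hr) k x)
    have h3 : m * ε < m * (C * monomialValue k fun n => r / τ n) := by
      calc m * ε = ε * m := mul_comm _ _
        _ < _ := h1
        _ = _ := by rw [hm]; ring
    have h4 := lt_of_mul_lt_mul_left h3 hm0
    rw [div_mul_eq_mul_div, le_div_iff₀ hε, one_mul]
    exact h4.le
  have h1 : (fun n => ‖x n‖ / (τ n ^ (j + 1) / r ^ j))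
      = (fun n => ‖x n‖ / τ n) * (fun n => r / τ n) ^ j := by
    ext n
    have := (hτ n).ne'
    simp only [Pi.mul_apply, Pi.pow_apply, div_pow]
    field_simp
    ring
  have h2 (z : ℕ → ℝ) : monomialValue k (z ^ j) = monomialValue k z ^ j := by
    simp only [monomialValue, Finsupp.prod, ← Finset.prod_pow, Pi.pow_apply, ← pow_mul,
      mul_comm j]
  have h3 := monomialValue_norm_div_nonneg hτ k x
  rw [h1, monomialValue_mul, h2]
  calc ‖component f R k x‖ ≤ C * (k.multinomial * monomialValue k fun n => ‖x n‖ / τ n) := hbound x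
    _ ≤ C * (k.multinomial * monomialValue k fun n => ‖x n‖ / τ n)
        * (C / ε * monomialValue k fun n => r / τ n) ^ j :=
        le_mul_of_one_le_right (by positivity) (one_le_pow₀ hlarge)
    _ = _ := by rw [mul_pow]; ring

/-- The components with large index sum to an entire function: near a given `x₀` the improved
weights `τ n ^ (j + 1) / r ^ j` are large enough for convergence if `j` is chosen large. -/
lemma differentiable_tsum_largeIndices [∀ n, FiniteDimensional ℂ (X n)] {f : lp X 1 → ℂ}
    {R r ε : ℝ} (hr : 0 < r) (hrR : r < R) (hε : 0 < ε)
    (hf : DifferentiableOn ℂ f (Metric.ball 0 R)) :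
    Differentiable ℂ fun x => ∑' k : largeIndices f R r ε, component f R k x := by
  intro x₀
  have hR : 0 < R := hr.trans hrR
  obtain ⟨ρ, hrρ, hρR⟩ := exists_between hrR
  have hρ : 0 < ρ := hr.trans hrρ
  obtain ⟨κ, hκr, hκ1⟩ := exists_between ((div_lt_one hρ).2 hrρ)
  have hκ0 : 0 < κ := (div_pos hr hρ).trans hκr
  have hgt : 1 < κ * ρ / r := by
    rw [one_lt_div hr]
    exact (div_lt_iff₀ hρ).1 hκr
  obtain ⟨j, hj⟩ := pow_unbounded_of_one_lt (‖x₀‖ / r) hgt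
  have hj1 : ‖x₀‖ / r < (κ * ρ / r) ^ (j + 1) :=
    hj.trans_le (pow_le_pow_right₀ hgt.le j.le_succ)
  have hsx := hasSum_norm_lp_one x₀
  obtain ⟨σ, hσ, hσρ, hσ0, θ, hθ, hsum⟩ := exists_tendsto_zero_sum_div_pow_le
    (a := fun n => ‖x₀ n‖ * (r ^ j / κ ^ (j + 1))) (fun n => by positivity)
    (hsx.summable.mul_right _) hρ (Nat.succ_ne_zero j) (by
      rw [tsum_mul_right, hsx.tsum_eq]
      rw [div_pow, mul_pow, div_lt_div_iff₀ hr (by positivity), pow_succ r j, ← mul_assoc] at hj1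
      rw [← mul_div_assoc, div_lt_iff₀ (by positivity), mul_comm (ρ ^ _)]
      exact lt_of_mul_lt_mul_right hj1 hr.le)
  obtain ⟨τ, ⟨c, hc, hcτ⟩, hτσ, C, hC, hbound⟩ :=
    exists_norm_component_le hR hf hρR hσ hσρ hσ0 hκ0 hκ1
  have hτ (n : ℕ) : 0 < τ n := hc.trans_le (hcτ n)
  set ν : ℕ → ℝ := fun n => τ n ^ (j + 1) / r ^ j
  have hFν (k : largeIndices f R r ε) (x : lp X 1) : ‖component f R k x‖ ≤ C * (C / ε) ^ j *
      ((k : ℕ →₀ ℕ).multinomial * monomialValue (k : ℕ →₀ ℕ) fun n => ‖x n‖ / ν n) :=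
    norm_component_le_of_mem_largeIndices hr hε hC hτ (hbound k) k.2 j x
  have hcν (n : ℕ) : c ^ (j + 1) / r ^ j ≤ ν n := by
    have := hcτ n
    simp only [ν]
    gcongr
  refine differentiableAt_tsum_of_multinomial_bound (e := Subtype.val)
    (F := fun k : largeIndices f R r ε => component f R k) Subtype.val_injective
    (fun k => differentiable_component hR hf k) (by positivity)
    (by positivity) hcν hFν hθ fun S => ?_
  refine le_trans (Finset.sum_le_sum fun n _ => ?_) (hsum S)
  have h1 : (κ * σ n) ^ (j + 1) / r ^ j ≤ τ n ^ (j + 1) / r ^ j := by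
    have := hτσ n
    have := mul_pos hκ0 (hσ n)
    gcongr
  refine (div_le_div_of_nonneg_left (norm_nonneg _)
    (div_pos (pow_pos (mul_pos hκ0 (hσ n)) _) (pow_pos hr _)) h1).trans (le_of_eq ?_)
  have := (hσ n).ne'
  rw [mul_pow]
  field_simp

/-- The form of the theorem with real radii. The approximation is the sum of the components of
large index. -/
lemma exists_entire_norm_sub_lt [∀ n, FiniteDimensional ℂ (X n)] {f : lp X 1 → ℂ} {R r ε : ℝ}
    (hr : 0 < r) (hrR : r < R) (hε : 0 < ε) (hf : DifferentiableOn ℂ f (Metric.ball 0 R)) :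
    ∃ g : lp X 1 → ℂ, Differentiable ℂ g ∧ ∀ x ∈ Metric.ball (0 : lp X 1) r, ‖f x - g x‖ < ε := by
  obtain ⟨r₁, hr₁, hr₁R⟩ := exists_between hrR
  have hr₁0 : 0 < r₁ := hr.trans hr₁
  have hR : 0 < R := hr.trans hrR
  have hq : r / r₁ < 1 := (div_lt_one hr₁0).2 hr₁
  have hq' : 0 < 1 - r / r₁ := sub_pos.2 hq
  -- the multinomial series is at most `(1 - r / r₁)⁻¹` on the ball of radius `r`
  set ε' : ℝ := ε * (1 - r / r₁) / 2
  have hε' : 0 < ε' := by positivity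
  set I : Set (ℕ →₀ ℕ) := largeIndices f R r₁ ε'
  refine ⟨_, differentiable_tsum_largeIndices hr₁0 hr₁R hε' hf, fun x hx => ?_⟩
  have hxR : x ∈ Metric.ball 0 R := Metric.ball_subset_ball hrR.le hx
  have hs := summable_component hR hf hxR
  have hfx := (hasSum_component hR hf hxR hs).tsum_eq
  have hsplit := hs.tsum_subtype_add_tsum_subtype_compl I
  rw [hfx] at hsplit
  rw [← hsplit, add_sub_cancel_left]
  rw [mem_ball_zero_iff] at hx
  have hsmall (k : (Iᶜ : Set (ℕ →₀ ℕ))) : ‖component f R k x‖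
      ≤ ε' * ((k : ℕ →₀ ℕ).multinomial * monomialValue (k : ℕ →₀ ℕ) fun n => ‖x n‖ / r₁) :=
    not_lt.1 fun h => k.2 ⟨x, h⟩
  have hsum := sum_norm_le_of_multinomial_bound (e := Subtype.val)
    (F := fun k : (Iᶜ : Set (ℕ →₀ ℕ)) => component f R k) Subtype.val_injective hε'.le
    (fun _ => hr₁0) hsmall hq fun S => by
      rw [← Finset.sum_div]
      gcongr
      exact (sum_le_hasSum S (fun _ _ => norm_nonneg _) (hasSum_norm_lp_one x)).trans hx.le
  have hsn : Summable fun k : (Iᶜ : Set (ℕ →₀ ℕ)) => ‖component f R k x‖ :=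
    summable_of_sum_le (fun _ => norm_nonneg _) hsum
  calc ‖∑' k : (Iᶜ : Set (ℕ →₀ ℕ)), component f R k x‖
      ≤ ∑' k : (Iᶜ : Set (ℕ →₀ ℕ)), ‖component f R k x‖ := norm_tsum_le_tsum_norm hsn
    _ ≤ ε' * (1 - r / r₁)⁻¹ := hsn.tsum_le_of_sum_le hsum
    _ = ε / 2 := by
        simp only [ε']
        rw [div_mul_eq_mul_div, mul_assoc, mul_inv_cancel₀ hq'.ne', mul_one]
    _ < ε := half_lt_self hε

end Splitting

/-- Here `lp X 1` is the `ℓ₁`-sum of the spaces `X n`, with norm `‖x‖ = ∑ ‖x n‖`; `Metric.eball 0 ρ`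
is the open ball `‖x‖ < ρ`, `0 < ρ ≤ ∞`; holomorphic means complex Fréchet differentiable on an
open set. -/
theorem theorem2p1 (X : ℕ → Type*) [∀ n, NormedAddCommGroup (X n)] [∀ n, NormedSpace ℂ (X n)]
    [∀ n, FiniteDimensional ℂ (X n)] (r R : ℝ≥0∞) (hr : 0 < r) (hrR : r < R)
    (ε : ℝ) (hε : 0 < ε) (f : lp X 1 → ℂ) (hf : DifferentiableOn ℂ f (Metric.eball 0 R)) :
    ∃ g : lp X 1 → ℂ, Differentiable ℂ g ∧
      ∀ x ∈ Metric.eball (0 : lp X 1) r, ‖f x - g x‖ < ε := by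
  obtain ⟨R', hrR', hR'R⟩ := ENNReal.lt_iff_exists_nnreal_btwn.1 hrR
  lift r to NNReal using hrR'.ne_top
  rw [Metric.eball_coe]
  refine exists_entire_norm_sub_lt (R := R') (by exact_mod_cast hr) (by exact_mod_cast hrR') hε
    (hf.mono ?_)
  rw [← Metric.eball_coe]
  exact Metric.eball_subset_eball hR'R.le
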